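/- Let $M$ be a $C^\infty$ real hypersurface in $\mathbb C^n$, let $p\in M$, and let $r$ be a local defining function for $M$ near $p$ (smooth, real-valued, $M=\{r=0\}$ near $p$, $\nabla r\ne 0$ where $r=0$). Let $\Gamma$ be the set of germs of nonconstant holomorphic curves $\gamma:(\mathbb C,0)\to(\mathbb C^n,p)$ with a good parametrization (that is, $\gamma$ is injective near $0$). For a map $h$ defined near $0\in\mathbb C$ let $\operatorname{ord}(h)\in\mathbb Z_{\ge 0}\cup\{\infty\}$ be its order of vanishing at $0$, i.e. the supremum of the $k$ with $h(t)=O(t^k)$ as $t\to0$. Put $\Gamma^{\rm reg}=\{\gamma\in\Gamma:\operatorname{ord}(\gamma-p)=1\}$ and $$\Delta_1(M,p)=\sup_{\gamma\in\Gamma}\frac{\operatorname{ord}(r\circ\gamma)}{\operatorname{ord}(\gamma-p)},\qquad \Delta_1^{\rm reg}(M,p)=\sup_{\gamma\in\Gamma^{\rm reg}}\operatorname{ord}(r\circ\gamma).$$ A curve $\gamma$ is *tangent to $M$ at $p$ to infinite order* if $(r\circ\gamma)(t)=O(t^N)$ as $t\to 0$ for every $N\in\mathbb N$. For a real-valued function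 $F$, smooth near $0\in\mathbb C^n$, with Taylor series $\sum_{\alpha,\beta}C_{\alpha\beta}z^\alpha\bar z^\beta$ at $0$, the *Newton polyhedron* $\mathcal N_+(F)$ is the convex hull of $\bigcup_{C_{\alpha\beta}\neq0}(\alpha+\beta+\mathbb R_{\ge0}^n)$. The function $F$ is *convenient* if $\mathcal N_+(F)$ meets every coordinate axis. For a (nonempty) compact face $\kappa$ of $\mathcal N_+(F)$ put $F_\kappa(z,\bar z)=\sum_{\alpha+\beta\in\kappa}C_{\alpha\beta}z^\alpha\bar z^\beta$. The function $F$ is *$\mathcal N$-nondegenerate* if for every compact face $\kappa$, every $c\in(\mathbb C\setminus\{0\})^n$ and every vector $a$ of positive integers such that $\kappa=\{\xi\in\mathcal N_+(F):\sum_j a_j\xi_j=l\}$ for some positive integer $l$, the function $F_\kappa$ does not vanish identically along the curve $t\mapsto(c_1t^{a_1},\dots,c_nt^{a_n})$, $t\in\mathbb C$. A holomorphic coordinate $(z)$ at $p$ with $p=0$ is *$\mathcal N$-canonical* for $M$ at $p$ if some local defining function for $M$ on $(z)$ is $\mathcal N$-nondegenerate. **Theorem 1.3.** If there exists an $\mathcal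 N$-canonical coordinate for $M$ at $p$, then the following five conditions are equivalent: 1. $\Delta_1(M,p)=\infty$; 2. $\Delta_1^{\rm reg}(M,p)=\infty$; 3. there exists a $\gamma\in\Gamma^{\rm reg}$ tangent to $M$ at $p$ to infinite order; 4. there exists a $\gamma\in\Gamma$ tangent to $M$ at $p$ to infinite order; 5. there exists a holomorphic coordinate $(z)$ at $p$ with $p=0$ such that a defining function for $M$ on $(z)$ is not convenient. In particular, if $M$ is of D'Angelo infinite type at $p$ (that is, $\Delta_1(M,p)=\infty$), then some regular holomorphic curve is tangent to $M$ at $p$ to infinite order. -/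

import Mathlib

open scoped ContDiff Topology

noncomputable section

namespace RealHypersurface

/-! ### Hypersurfaces, defining functions, holomorphic coordinates

The space `ℂⁿ` is modelled by `Fin n → ℂ`; only its topology and its smooth structure are used. -/

/-- `r` is a `C^∞` local defining function near `p` for the real hypersurface `M` of `ℂⁿ`:
on some open neighbourhood `U` of `p`, `r` is smooth, `M` is the zero set of `r`, and
`∇r ≠ 0` where `r = 0`. (Smoothness and gradient are those over `ℝ`.) -/
def IsLocalDefiningFunction {n : ℕ} (M : Set (Fin n → ℂ)) (p : Fin n → ℂ)
    (r : (Fin n → ℂ) → ℝ) : Prop :=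
  ∃ U : Set (Fin n → ℂ), IsOpen U ∧ p ∈ U ∧ ContDiffOn ℝ ∞ r U ∧
    (∀ z ∈ U, z ∈ M ↔ r z = 0) ∧ ∀ z ∈ U, r z = 0 → fderiv ℝ r z ≠ 0

/-- `Φ` is a holomorphic coordinate at `p` with `p = 0`: a biholomorphic map from an open
neighbourhood of `p` onto an open neighbourhood of `0` sending `p` to `0`. -/
structure IsHolomorphicCoordinate {n : ℕ} (p : Fin n → ℂ)
    (Φ : OpenPartialHomeomorph (Fin n → ℂ) (Fin n → ℂ)) : Prop where
  mem_source : p ∈ Φ.source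
  map_eq_zero : Φ p = 0
  differentiableOn : DifferentiableOn ℂ Φ Φ.source
  differentiableOn_symm : DifferentiableOn ℂ Φ.symm Φ.target

/-- `r` is a local defining function, near the origin, for `M` written in the coordinate `Φ`. -/
def IsDefiningFunctionOn {n : ℕ} (M : Set (Fin n → ℂ))
    (Φ : OpenPartialHomeomorph (Fin n → ℂ) (Fin n → ℂ)) (r : (Fin n → ℂ) → ℝ) : Prop :=
  IsLocalDefiningFunction (Φ '' (Φ.source ∩ M)) 0 r

/-! ### Holomorphic curves and types -/

/-- The order of vanishing at `0` of a map `h` on `ℂ` (`⊤` if `h` vanishes to infinite order):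
the supremum of the `k` with `h(t) = O(t ^ k)` as `t → 0`. -/
def ord {E : Type*} [NormedAddCommGroup E] (h : ℂ → E) : ℕ∞ :=
  ⨆ (k : ℕ) (_ : h =O[𝓝 0] fun t : ℂ => t ^ k), (k : ℕ∞)

/-- The set `Γ` of (representatives of germs of) nonconstant holomorphic curves
`γ : (ℂ, 0) → (ℂⁿ, p)` with a good parametrization, that is, each point of the curve
is `γ t` for only one value of `t` near `0`. -/
def curves {n : ℕ} (p : Fin n → ℂ) : Set (ℂ → Fin n → ℂ) :=
  {γ | AnalyticAt ℂ γ 0 ∧ γ 0 = p ∧ (¬ ∀ᶠ t in 𝓝 (0 : ℂ), γ t = p) ∧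
    ∃ V ∈ 𝓝 (0 : ℂ), Set.InjOn γ V}

/-- The set `Γ^reg` of regular curves: those of order one. -/
def regularCurves {n : ℕ} (p : Fin n → ℂ) : Set (ℂ → Fin n → ℂ) :=
  {γ | γ ∈ curves p ∧ ord (fun t => γ t - p) = 1}

/-- The D'Angelo type `Δ₁`, computed with the defining function `r`. The denominators are
finite and nonzero, since the curves are nonconstant and pass through `p`. -/
def dAngeloType {n : ℕ} (r : (Fin n → ℂ) → ℝ) (p : Fin n → ℂ) : ENNReal :=
  ⨆ γ ∈ curves p,
    (ord (fun t => r (γ t)) : ENNReal) / (ord (fun t => γ t - p) : ENNReal)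

/-- The regular type `Δ₁^reg`, computed with the defining function `r`. -/
def regularType {n : ℕ} (r : (Fin n → ℂ) → ℝ) (p : Fin n → ℂ) : ℕ∞ :=
  ⨆ γ ∈ regularCurves p, ord (fun t => r (γ t))

/-- `γ` is tangent to infinite order to the hypersurface defined by `r`. -/
def IsTangentToInfiniteOrder {n : ℕ} (r : (Fin n → ℂ) → ℝ) (γ : ℂ → Fin n → ℂ) : Prop :=
  ∀ N : ℕ, (fun t => r (γ t)) =O[𝓝 0] fun t : ℂ => t ^ N

/-! ### Newton polyhedra -/

/-- The Wirtinger derivative `∂/∂z_j = (∂/∂x_j - i ∂/∂y_j) / 2`. -/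
def dz {n : ℕ} (j : Fin n) (G : (Fin n → ℂ) → ℂ) : (Fin n → ℂ) → ℂ := fun z =>
  (fderiv ℝ G z (Pi.single j 1) - Complex.I * fderiv ℝ G z (Pi.single j Complex.I)) / 2

/-- The Wirtinger derivative `∂/∂z̄_j = (∂/∂x_j + i ∂/∂y_j) / 2`. -/
def dzbar {n : ℕ} (j : Fin n) (G : (Fin n → ℂ) → ℂ) : (Fin n → ℂ) → ℂ := fun z =>
  (fderiv ℝ G z (Pi.single j 1) + Complex.I * fderiv ℝ G z (Pi.single j Complex.I)) / 2

/-- `D^α = ∂^|α| / ∂z₁^α₁ ⋯ ∂zₙ^αₙ`. -/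
def iteratedDz {n : ℕ} (α : Fin n → ℕ) (G : (Fin n → ℂ) → ℂ) : (Fin n → ℂ) → ℂ :=
  (List.finRange n).foldr (fun j H => (dz j)^[α j] H) G

/-- `D̄^β = ∂^|β| / ∂z̄₁^β₁ ⋯ ∂z̄ₙ^βₙ`. -/
def iteratedDzbar {n : ℕ} (β : Fin n → ℕ) (G : (Fin n → ℂ) → ℂ) : (Fin n → ℂ) → ℂ :=
  (List.finRange n).foldr (fun j H => (dzbar j)^[β j] H) G

/-- The coefficient `C_{αβ}` of `z^α z̄^β` in the Taylor series at the origin of a real-valued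
function `F`, smooth near the origin of `ℂⁿ`. -/
def taylorCoeff {n : ℕ} (F : (Fin n → ℂ) → ℝ) (α β : Fin n → ℕ) : ℂ :=
  iteratedDz α (iteratedDzbar β fun z => (F z : ℂ)) 0 /
    ((∏ j, ((α j).factorial : ℂ)) * ∏ j, ((β j).factorial : ℂ))

/-- The point of `ℝⁿ` with coordinates `α_j + β_j`. -/
def exponentPoint {n : ℕ} (α β : Fin n → ℕ) : Fin n → ℝ := fun j => (α j : ℝ) + (β j : ℝ)

/-- The Newton polyhedron `𝒩₊(F)`: the convex hull of the union of the orthants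
`α + β + ℝ₊ⁿ` over all `α`, `β` with `C_{αβ} ≠ 0`. -/
def newtonPolyhedron {n : ℕ} (F : (Fin n → ℂ) → ℝ) : Set (Fin n → ℝ) :=
  convexHull ℝ {ξ | ∃ α β : Fin n → ℕ, taylorCoeff F α β ≠ 0 ∧ exponentPoint α β ≤ ξ}

/-- `F` is convenient: its Newton polyhedron meets every coordinate axis. -/
def IsConvenient {n : ℕ} (F : (Fin n → ℂ) → ℝ) : Prop :=
  ∀ k : Fin n, ∃ ξ ∈ newtonPolyhedron F, ∀ j, j ≠ k → ξ j = 0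

/-- `κ` is a (nonempty) compact face of `P`: it is compact, and it is cut out from `P` by a
supporting hyperplane. -/
def IsCompactFace {n : ℕ} (P κ : Set (Fin n → ℝ)) : Prop :=
  κ.Nonempty ∧ IsCompact κ ∧
    ∃ (a : Fin n → ℝ) (l : ℝ), (∀ ξ ∈ P, l ≤ ∑ j, a j * ξ j) ∧
      κ = {ξ | ξ ∈ P ∧ ∑ j, a j * ξ j = l}

/-- The `κ`-part of `F`, `∑_{α + β ∈ κ} C_{αβ} z^α z̄^β`; the sum is finite as soon as `κ` is
compact. -/
def part {n : ℕ} (F : (Fin n → ℂ) → ℝ) (κ : Set (Fin n → ℝ)) (z : Fin n → ℂ) : ℂ :=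
  ∑ᶠ q ∈ {q : (Fin n → ℕ) × (Fin n → ℕ) | exponentPoint q.1 q.2 ∈ κ},
    taylorCoeff F q.1 q.2 * ((∏ j, z j ^ q.1 j) * ∏ j, (starRingEnd ℂ (z j)) ^ q.2 j)

/-- The vector `a` of positive integers determines the subset `κ` of `P`:
`κ = {ξ ∈ P | ∑ a_j ξ_j = l}` for some positive integer `l`. -/
def Determines {n : ℕ} (P κ : Set (Fin n → ℝ)) (a : Fin n → ℕ) : Prop :=
  (∀ j, 0 < a j) ∧ ∃ l : ℕ, 0 < l ∧ {ξ | ξ ∈ P ∧ ∑ j, (a j : ℝ) * ξ j = l} = κ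

/-- `F` is `𝒩`-nondegenerate: for every compact face `κ` of `𝒩₊(F)`, every `a` that determines
`κ` and all nonzero `c₁, …, cₙ`, the `κ`-part of `F` does not vanish identically along the curve
`t ↦ (c₁ t^a₁, …, cₙ t^aₙ)`. -/
def IsNondegenerate {n : ℕ} (F : (Fin n → ℂ) → ℝ) : Prop :=
  ∀ κ, IsCompactFace (newtonPolyhedron F) κ →
    ∀ (a : Fin n → ℕ) (c : Fin n → ℂ), Determines (newtonPolyhedron F) κ a → (∀ j, c j ≠ 0) →
      ∃ t : ℂ, part F κ (fun j => c j * t ^ a j) ≠ 0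

/-- `Φ` is an `𝒩`-canonical coordinate for `M` at `p`. -/
def IsCanonicalCoordinate {n : ℕ} (M : Set (Fin n → ℂ)) (p : Fin n → ℂ)
    (Φ : OpenPartialHomeomorph (Fin n → ℂ) (Fin n → ℂ)) : Prop :=
  IsHolomorphicCoordinate p Φ ∧ ∃ r, IsDefiningFunctionOn M Φ r ∧ IsNondegenerate r

end RealHypersurface

end

open RealHypersurface

/-!
The five conditions are linked through a bound on the contact of curves in one direction, and a
coordinate axis in the other.

If a defining function `ρ` in some holomorphic coordinate is not convenient, its Newton polyhedron
misses the `k`-th axis. Then all Taylor coefficients of `ρ` in the variables `z_k`, `z̄_k` alone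
vanish, and the `k`-th coordinate line is a regular curve tangent to infinite order
(`exists_regular_tangent`). The conditions on tangent curves imply those on the types at once.

Conversely, suppose that the canonical coordinate has a nondegenerate defining function `ρ` that is
convenient. Let `η` be a curve with components of orders `a_j` and leading coefficients `c_j ≠ 0`,
and let `l` be the minimum of `∑ a_j ξ_j` on the Newton polyhedron. By Taylor's formula
(`taylor_isBigO`), `ρ ∘ η` is the face part of `ρ` along `c_j t ^ a_j` up to `O(t ^ (l + 1))`
(`isBigO_sub_lowestPart`); this part is homogeneous of degree `l` under real dilations of `t` and
not identically zero, hence `ord (ρ ∘ η) ≤ l` (`exists_contact_order`). Convenience provides a point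
on the axis of the component of smallest order `d`, whence `l ≤ m * d` with `m` depending on `ρ`
only (`exists_ord_le_mul`). A component that vanishes identically is first replaced by a power of `t` so
high that the contact up to order `m * d` does not change. So both types are at most `m`.

Orders of contact depend neither on the defining function nor on the coordinate, because two
defining functions bound each other near the point up to a constant (`isBigO_comp_definingFunction`).
-/

open scoped ContDiff Topology
open RealHypersurface

namespace RealHypersurface

noncomputable section

open Asymptotics Set

variable {n : ℕ}

/-! ### Wirtinger derivatives -/

/-- The Wirtinger derivative of index `s`: `∂/∂z_j` for `s = inl j` and `∂/∂z̄_j` for `s = inr j`.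
Treating both families at once turns a pair of multi-indices `(α, β)` into the single multi-index
`Sum.elim α β`. -/
def wirtinger : Fin n ⊕ Fin n → ((Fin n → ℂ) → ℂ) → (Fin n → ℂ) → ℂ :=
  Sum.elim dz dzbar

/-- The real-linear coordinate of index `s`: `z_j` for `s = inl j`, `z̄_j` for `s = inr j`. -/
def coord : Fin n ⊕ Fin n → (Fin n → ℂ) →L[ℝ] ℂ :=
  Sum.elim (fun j => ContinuousLinearMap.proj j)
    (fun j => (Complex.conjCLE : ℂ →L[ℝ] ℂ).comp (ContinuousLinearMap.proj j))

/-- The Wirtinger derivative of index `s` as a function of the real differential. -/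
def wirtingerForm : Fin n ⊕ Fin n → ((Fin n → ℂ) →L[ℝ] ℂ) →L[ℝ] ℂ :=
  Sum.elim
    (fun j => (2⁻¹ : ℂ) • (ContinuousLinearMap.apply ℝ ℂ (Pi.single j (1 : ℂ))
      + (-Complex.I) • ContinuousLinearMap.apply ℝ ℂ (Pi.single j Complex.I)))
    (fun j => (2⁻¹ : ℂ) • (ContinuousLinearMap.apply ℝ ℂ (Pi.single j (1 : ℂ))
      + Complex.I • ContinuousLinearMap.apply ℝ ℂ (Pi.single j Complex.I)))

theorem wirtinger_apply (s : Fin n ⊕ Fin n) (G : (Fin n → ℂ) → ℂ) (z : Fin n → ℂ) :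
    wirtinger s G z = wirtingerForm s (fderiv ℝ G z) := by
  rcases s with j | j <;> simp [wirtinger, wirtingerForm, dz, dzbar] <;> ring

theorem wirtingerForm_smul (s : Fin n ⊕ Fin n) (a : ℂ) (T : (Fin n → ℂ) →L[ℝ] ℂ) :
    wirtingerForm s (a • T) = a * wirtingerForm s T := by
  rcases s with j | j <;> simp [wirtingerForm] <;> ring

/-- The coordinates `z_j`, `z̄_j` are dual to the Wirtinger derivatives. -/
theorem wirtingerForm_coord (s s' : Fin n ⊕ Fin n) :
    wirtingerForm s (coord s') = if s' = s then 1 else 0 := by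
  rcases s with j | j <;> rcases s' with i | i <;>
    by_cases h : i = j <;>
    simp [wirtingerForm, coord, h] <;> norm_num

/-- The identity `dG = ∑ ∂G/∂z_j dz_j + ∑ ∂G/∂z̄_j dz̄_j`. -/
theorem eq_sum_wirtingerForm_smul_coord (T : (Fin n → ℂ) →L[ℝ] ℂ) :
    T = ∑ s, wirtingerForm s T • coord s := by
  ext v
  have hv : v = ∑ j, ((v j).re • (Pi.single j 1 : Fin n → ℂ)
      + (v j).im • (Pi.single j Complex.I : Fin n → ℂ)) := by
    ext i
    simp [Finset.sum_apply, Pi.single_apply, Finset.sum_add_distrib]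
  conv_lhs => rw [hv]
  simp only [map_sum, map_add, map_smul, Fintype.sum_sum_type, ← Finset.sum_add_distrib,
    sum_apply, add_apply]
  refine Finset.sum_congr rfl fun j _ => ?_
  have h1 := Complex.re_add_im (v j)
  have h2 : (starRingEnd ℂ) (v j) = (v j).re - (v j).im * Complex.I := by
    apply Complex.ext <;> simp
  simp [wirtingerForm, coord, h2]
  generalize T (Pi.single j 1) = A
  generalize T (Pi.single j Complex.I) = B
  generalize (v j).re = x at h1
  generalize (v j).im = y at h1
  rw [← h1]
  linear_combination (y : ℂ) * B * Complex.I_sq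

theorem wirtinger_contDiffOn {U : Set (Fin n → ℂ)} (hU : IsOpen U) {G : (Fin n → ℂ) → ℂ}
    (hG : ContDiffOn ℝ ∞ G U) (s : Fin n ⊕ Fin n) : ContDiffOn ℝ ∞ (wirtinger s G) U := by
  have h : wirtinger s G = fun z => wirtingerForm s (fderiv ℝ G z) :=
    funext (wirtinger_apply s G)
  rw [h]
  exact (wirtingerForm s).contDiff.comp_contDiffOn (hG.fderiv_of_isOpen hU (by simp))

theorem wirtinger_congr {U : Set (Fin n → ℂ)} (hU : IsOpen U) {G H : (Fin n → ℂ) → ℂ}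
    (h : EqOn G H U) (s : Fin n ⊕ Fin n) : EqOn (wirtinger s G) (wirtinger s H) U := by
  intro z hz
  rw [wirtinger_apply, wirtinger_apply, (h.eventuallyEq_of_mem (hU.mem_nhds hz)).fderiv_eq]

/-- Wirtinger derivatives commute on smooth functions, by symmetry of the second differential. -/
theorem wirtinger_comm {U : Set (Fin n → ℂ)} (hU : IsOpen U) {G : (Fin n → ℂ) → ℂ}
    (hG : ContDiffOn ℝ ∞ G U) (s s' : Fin n ⊕ Fin n) :
    EqOn (wirtinger s (wirtinger s' G)) (wirtinger s' (wirtinger s G)) U := by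
  intro z hz
  have hGz : ContDiffAt ℝ ∞ G z := hG.contDiffAt (hU.mem_nhds hz)
  have hd : DifferentiableAt ℝ (fderiv ℝ G) z :=
    (hGz.fderiv_right (m := ∞) (by simp)).differentiableAt (by simp)
  have key : ∀ s s' : Fin n ⊕ Fin n, wirtinger s (wirtinger s' G) z
      = wirtingerForm s ((wirtingerForm s').comp (fderiv ℝ (fderiv ℝ G) z)) := by
    intro s s'
    rw [wirtinger_apply, funext (wirtinger_apply s' G)]
    congr 1
    exact ((wirtingerForm s').hasFDerivAt.comp z hd.hasFDerivAt).fderiv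
  have hsymm : IsSymmSndFDerivAt ℝ G z :=
    hGz.isSymmSndFDerivAt (by simpa using WithTop.coe_le_coe.2 (le_top : (2 : ℕ∞) ≤ ⊤))
  rw [key, key]
  have hs := fun u v => hsymm u v
  rcases s with j | j <;> rcases s' with i | i <;>
    simp only [wirtingerForm, Sum.elim_inl, Sum.elim_inr, smul_apply, add_apply,
      ContinuousLinearMap.apply_apply, ContinuousLinearMap.comp_apply, smul_eq_mul] <;>
    simp only [hs (Pi.single j _) (Pi.single i _)] <;> ring

theorem wirtinger_add_smul {U : Set (Fin n → ℂ)} (hU : IsOpen U) {G H : (Fin n → ℂ) → ℂ}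
    (hG : ContDiffOn ℝ ∞ G U) (hH : ContDiffOn ℝ ∞ H U) (a : ℂ) (s : Fin n ⊕ Fin n) :
    EqOn (wirtinger s (G + a • H)) (wirtinger s G + a • wirtinger s H) U := by
  intro z hz
  have hGz := (hG.contDiffAt (hU.mem_nhds hz)).differentiableAt (by simp)
  have hHz := (hH.contDiffAt (hU.mem_nhds hz)).differentiableAt (by simp)
  simp only [wirtinger_apply, Pi.add_apply, Pi.smul_apply]
  rw [fderiv_add hGz (hHz.const_smul a), fderiv_const_smul hHz, map_add, wirtingerForm_smul,
    smul_eq_mul]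

/-! ### Iterated Wirtinger derivatives -/

/-- The derivative of multi-index `q` in the variables of the list `l`, the head of the list being
the outermost one. -/
def iteratedWirtinger (l : List (Fin n ⊕ Fin n)) (q : Fin n ⊕ Fin n → ℕ)
    (G : (Fin n → ℂ) → ℂ) : (Fin n → ℂ) → ℂ :=
  l.foldr (fun s H => (wirtinger s)^[q s] H) G

section
variable {U : Set (Fin n → ℂ)} (hU : IsOpen U) {G H : (Fin n → ℂ) → ℂ}
include hU

theorem wirtinger_iterate_contDiffOn (hG : ContDiffOn ℝ ∞ G U) (s : Fin n ⊕ Fin n) (k : ℕ) :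
    ContDiffOn ℝ ∞ ((wirtinger s)^[k] G) U := by
  induction k with
  | zero => exact hG
  | succ k ih => rw [Function.iterate_succ_apply']; exact wirtinger_contDiffOn hU ih s

theorem wirtinger_iterate_congr (h : EqOn G H U) (s : Fin n ⊕ Fin n) (k : ℕ) :
    EqOn ((wirtinger s)^[k] G) ((wirtinger s)^[k] H) U := by
  induction k with
  | zero => exact h
  | succ k ih => rw [Function.iterate_succ_apply', Function.iterate_succ_apply']
                 exact wirtinger_congr hU ih s

theorem wirtinger_iterate_comm (hG : ContDiffOn ℝ ∞ G U) (s s' : Fin n ⊕ Fin n) (k : ℕ) :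
    EqOn (wirtinger s ((wirtinger s')^[k] G)) ((wirtinger s')^[k] (wirtinger s G)) U := by
  induction k with
  | zero => exact fun _ _ => rfl
  | succ k ih =>
    rw [Function.iterate_succ_apply', Function.iterate_succ_apply']
    exact (wirtinger_comm hU (wirtinger_iterate_contDiffOn hU hG s' k) s s').trans
      (wirtinger_congr hU ih s')

theorem iteratedWirtinger_contDiffOn (l : List (Fin n ⊕ Fin n)) (q : Fin n ⊕ Fin n → ℕ)
    (hG : ContDiffOn ℝ ∞ G U) : ContDiffOn ℝ ∞ (iteratedWirtinger l q G) U := by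
  induction l with
  | nil => exact hG
  | cons s l ih => exact wirtinger_iterate_contDiffOn hU ih s _

theorem iteratedWirtinger_congr (l : List (Fin n ⊕ Fin n)) (q : Fin n ⊕ Fin n → ℕ)
    (h : EqOn G H U) : EqOn (iteratedWirtinger l q G) (iteratedWirtinger l q H) U := by
  induction l with
  | nil => exact h
  | cons s l ih => exact wirtinger_iterate_congr hU ih s _

theorem wirtinger_iteratedWirtinger (l : List (Fin n ⊕ Fin n)) (q : Fin n ⊕ Fin n → ℕ)
    (hG : ContDiffOn ℝ ∞ G U) (s : Fin n ⊕ Fin n) :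
    EqOn (wirtinger s (iteratedWirtinger l q G)) (iteratedWirtinger l q (wirtinger s G)) U := by
  induction l with
  | nil => exact fun _ _ => rfl
  | cons s' l ih =>
    exact (wirtinger_iterate_comm hU (iteratedWirtinger_contDiffOn hU l q hG) s s' _).trans
      (wirtinger_iterate_congr hU ih s' _)

omit hU in
theorem iteratedWirtinger_add_single_of_notMem {l : List (Fin n ⊕ Fin n)} {s : Fin n ⊕ Fin n}
    (hs : s ∉ l) (q : Fin n ⊕ Fin n → ℕ) :
    iteratedWirtinger l (q + Pi.single s 1) G = iteratedWirtinger l q G := by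
  induction l with
  | nil => rfl
  | cons s' l ih =>
    rw [List.mem_cons, not_or] at hs
    have h := ih hs.2
    simp only [iteratedWirtinger, List.foldr_cons] at h ⊢
    rw [h]
    simp [Ne.symm hs.1]

/-- Raising the entry `s` of the multi-index by one amounts to differentiating once more,
first of all, in the variable `s`. -/
theorem iteratedWirtinger_add_single {l : List (Fin n ⊕ Fin n)} (hl : l.Nodup)
    {s : Fin n ⊕ Fin n} (hs : s ∈ l) (q : Fin n ⊕ Fin n → ℕ) (hG : ContDiffOn ℝ ∞ G U) :
    EqOn (iteratedWirtinger l (q + Pi.single s 1) G) (iteratedWirtinger l q (wirtinger s G)) U := by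
  induction l with
  | nil => simp at hs
  | cons s' l ih =>
    rw [List.nodup_cons] at hl
    rw [List.mem_cons] at hs
    rcases eq_or_ne s s' with rfl | hne
    · have h := iteratedWirtinger_add_single_of_notMem (G := G) hl.1 q
      have h2 := wirtinger_iteratedWirtinger hU l q hG s
      simp only [iteratedWirtinger, List.foldr_cons] at h h2 ⊢
      rw [h]
      simp only [Pi.add_apply, Pi.single_eq_same, Function.iterate_succ_apply]
      exact wirtinger_iterate_congr hU h2 s _
    · have h := ih hl.2 (hs.resolve_left hne)
      simp only [iteratedWirtinger, List.foldr_cons] at h ⊢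
      have e : (q + Pi.single s 1 : Fin n ⊕ Fin n → ℕ) s' = q s' := by simp [Ne.symm hne]
      rw [e]
      exact wirtinger_iterate_congr hU h s' _
end

/-! ### Taylor coefficients -/

/-- All the indices, in the order in which `taylorCoeff` differentiates. -/
def allIndices (n : ℕ) : List (Fin n ⊕ Fin n) :=
  (List.finRange n).map Sum.inl ++ (List.finRange n).map Sum.inr

theorem nodup_allIndices : (allIndices n).Nodup := by
  refine List.Nodup.append ((List.nodup_finRange n).map Sum.inl_injective)
    ((List.nodup_finRange n).map Sum.inr_injective) ?_
  simp [List.Disjoint]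

theorem mem_allIndices (s : Fin n ⊕ Fin n) : s ∈ allIndices n := by
  rcases s with j | j <;> simp [allIndices]

/-- The Taylor coefficient at the origin, of multi-index `q`, of a complex-valued function. -/
def coeffAt (q : Fin n ⊕ Fin n → ℕ) (G : (Fin n → ℂ) → ℂ) : ℂ :=
  iteratedWirtinger (allIndices n) q G 0 / ∏ s, ((q s).factorial : ℂ)

theorem taylorCoeff_eq_coeffAt (F : (Fin n → ℂ) → ℝ) (α β : Fin n → ℕ) :
    taylorCoeff F α β = coeffAt (Sum.elim α β) fun z => (F z : ℂ) := by
  simp [taylorCoeff, coeffAt, iteratedWirtinger, allIndices, iteratedDz, iteratedDzbar,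
    List.foldr_map, wirtinger, Fintype.prod_sum_type]

theorem coeffAt_zero (G : (Fin n → ℂ) → ℂ) : coeffAt 0 G = G 0 := by
  have h : ∀ l : List (Fin n ⊕ Fin n), iteratedWirtinger l 0 G = G := by
    intro l
    induction l with
    | nil => rfl
    | cons s l ih => exact ih
  simp [coeffAt, h]

/-- The monomial `z^α z̄^β`, where `q = Sum.elim α β`. -/
def mixedMonomial (q : Fin n ⊕ Fin n → ℕ) (z : Fin n → ℂ) : ℂ := ∏ s, coord s z ^ q s

theorem mixedMonomial_contDiff (q : Fin n ⊕ Fin n → ℕ) : ContDiff ℝ ∞ (mixedMonomial q) :=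
  contDiff_prod fun s _ => (coord s).contDiff.pow (q s)

theorem wirtinger_mixedMonomial (s : Fin n ⊕ Fin n) (q : Fin n ⊕ Fin n → ℕ) :
    wirtinger s (mixedMonomial q) = (q s : ℂ) • mixedMonomial (q - Pi.single s 1) := by
  funext z
  have h : HasFDerivAt (mixedMonomial q)
      (∑ s, (∏ s' ∈ Finset.univ.erase s, coord s' z ^ q s') •
        ((q s * coord s z ^ (q s - 1) : ℂ) • coord s)) z :=
    HasFDerivAt.finsetProd fun s _ => by
      simpa using (coord s).hasFDerivAt.pow (q s)
  rw [wirtinger_apply, h.fderiv, map_sum, Finset.sum_eq_single s]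
  · rw [wirtingerForm_smul, wirtingerForm_smul, wirtingerForm_coord, if_pos rfl, Pi.smul_apply,
      mixedMonomial, ← Finset.mul_prod_erase _ _ (Finset.mem_univ s)]
    have : ∏ x ∈ Finset.univ.erase s, coord x z ^ (q - Pi.single s 1 : Fin n ⊕ Fin n → ℕ) x
        = ∏ x ∈ Finset.univ.erase s, coord x z ^ q x :=
      Finset.prod_congr rfl fun x hx => by
        simp [Finset.ne_of_mem_erase hx]
    rw [this]
    simp
    ring
  · intro s' _ hs'
    rw [wirtingerForm_smul, wirtingerForm_smul, wirtingerForm_coord, if_neg hs']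
    simp
  · simp

/-- Induction on multi-indices, raising one entry by one at each step. -/
theorem multiIndex_induction {P : (Fin n ⊕ Fin n → ℕ) → Prop} (q : Fin n ⊕ Fin n → ℕ)
    (zero : P 0) (succ : ∀ q s, P q → P (q + Pi.single s 1)) : P q := by
  obtain ⟨N, hN⟩ : ∃ N, ∑ s, q s = N := ⟨_, rfl⟩
  induction N generalizing q with
  | zero =>
    have : q = 0 := funext fun s => by
      simpa using (Finset.sum_eq_zero_iff.1 hN) s (Finset.mem_univ s)
    rwa [this]
  | succ N ih =>
    obtain ⟨s, hs⟩ : ∃ s, q s ≠ 0 := by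
      by_contra! h
      simp [h] at hN
    have hq : q = (q - Pi.single s 1) + Pi.single s 1 := by
      ext x
      by_cases hx : x = s
      · subst hx; simp; omega
      · simp [hx]
    rw [hq]
    refine succ _ s (ih _ ?_)
    have h2 := congrArg (fun f : Fin n ⊕ Fin n → ℕ => ∑ x, f x) hq
    simp only [Pi.add_apply, Finset.sum_add_distrib, Finset.sum_pi_single'] at h2
    simp only [Finset.mem_univ, if_true] at h2
    omega

/-- The finite set of the multi-indices with all entries smaller than `N`. -/
def box (n N : ℕ) : Finset (Fin n ⊕ Fin n → ℕ) := Fintype.piFinset fun _ => Finset.range N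

theorem mem_box {N : ℕ} {q : Fin n ⊕ Fin n → ℕ} : q ∈ box n N ↔ ∀ s, q s < N := by
  simp [box]

section
variable {U : Set (Fin n → ℂ)} (hU : IsOpen U) (h0 : (0 : Fin n → ℂ) ∈ U)
  {G H : (Fin n → ℂ) → ℂ}
include hU h0

theorem coeffAt_congr (h : EqOn G H U) (q : Fin n ⊕ Fin n → ℕ) : coeffAt q G = coeffAt q H := by
  rw [coeffAt, coeffAt, iteratedWirtinger_congr hU _ q h h0]

/-- The Taylor coefficients of a derivative. This recursion replaces the computation of iterated
derivatives in what follows. -/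
theorem coeffAt_add_single (hG : ContDiffOn ℝ ∞ G U) (q : Fin n ⊕ Fin n → ℕ)
    (s : Fin n ⊕ Fin n) :
    (q s + 1 : ℂ) * coeffAt (q + Pi.single s 1) G = coeffAt q (wirtinger s G) := by
  rw [coeffAt, coeffAt, iteratedWirtinger_add_single hU nodup_allIndices (mem_allIndices s) q hG h0]
  have hp : ∏ x, (((q + Pi.single s 1 : Fin n ⊕ Fin n → ℕ) x).factorial : ℂ)
      = (q s + 1) * ∏ x, ((q x).factorial : ℂ) := by
    rw [← Finset.mul_prod_erase _ _ (Finset.mem_univ s),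
      ← Finset.mul_prod_erase _ (fun x => ((q x).factorial : ℂ)) (Finset.mem_univ s)]
    have : ∏ x ∈ Finset.univ.erase s, (((q + Pi.single s 1 : Fin n ⊕ Fin n → ℕ) x).factorial : ℂ)
        = ∏ x ∈ Finset.univ.erase s, ((q x).factorial : ℂ) :=
      Finset.prod_congr rfl fun x hx => by
        simp [Finset.ne_of_mem_erase hx]
    rw [this]
    simp [Nat.factorial_succ]
    ring
  have h1 : (q s + 1 : ℂ) ≠ 0 := Nat.cast_add_one_ne_zero _
  have h2 : ∏ x, ((q x).factorial : ℂ) ≠ 0 :=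
    Finset.prod_ne_zero_iff.2 fun x _ => by exact_mod_cast Nat.factorial_ne_zero _
  rw [hp]
  field_simp

theorem coeffAt_add_smul (hG : ContDiffOn ℝ ∞ G U) (hH : ContDiffOn ℝ ∞ H U) (a : ℂ)
    (q : Fin n ⊕ Fin n → ℕ) : coeffAt q (G + a • H) = coeffAt q G + a * coeffAt q H := by
  induction q using multiIndex_induction generalizing G H with
  | zero => simp [coeffAt_zero]
  | succ q s ih =>
    have h1 : (q s + 1 : ℂ) ≠ 0 := Nat.cast_add_one_ne_zero _
    refine mul_left_cancel₀ h1 ?_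
    rw [coeffAt_add_single hU h0 (G := G + a • H) (hG.add (hH.const_smul a)),
      coeffAt_congr hU h0 (wirtinger_add_smul hU hG hH a s),
      ih (wirtinger_contDiffOn hU hG s) (wirtinger_contDiffOn hU hH s), mul_add,
      mul_left_comm, coeffAt_add_single hU h0 hG, coeffAt_add_single hU h0 hH]

omit hU h0 in
theorem coeffAt_mixedMonomial (q q' : Fin n ⊕ Fin n → ℕ) :
    coeffAt q (mixedMonomial q') = if q = q' then 1 else 0 := by
  induction q using multiIndex_induction generalizing q' with
  | zero =>
    rw [coeffAt_zero]
    split_ifs with h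
    · simp [← h, mixedMonomial]
    · obtain ⟨s, hs⟩ : ∃ s, q' s ≠ 0 := by
        by_contra! h'
        exact h (funext fun s => (h' s).symm)
      exact Finset.prod_eq_zero (Finset.mem_univ s) (by simp [hs])
  | succ q s ih =>
    have h1 : (q s + 1 : ℂ) ≠ 0 := Nat.cast_add_one_ne_zero _
    refine mul_left_cancel₀ h1 ?_
    have hm : ContDiffOn ℝ ∞ (mixedMonomial (q' - Pi.single s 1)) univ :=
      (mixedMonomial_contDiff _).contDiffOn
    have h0m : ContDiffOn ℝ ∞ (0 : (Fin n → ℂ) → ℂ) univ := contDiffOn_const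
    have hz : coeffAt q (0 : (Fin n → ℂ) → ℂ) = 0 := by
      have := coeffAt_add_smul isOpen_univ (mem_univ 0) h0m h0m (-1) q
      simpa using this
    rw [coeffAt_add_single isOpen_univ (mem_univ 0) (mixedMonomial_contDiff q').contDiffOn,
      wirtinger_mixedMonomial,
      ← zero_add ((q' s : ℂ) • mixedMonomial (q' - Pi.single s 1)),
      coeffAt_add_smul isOpen_univ (mem_univ 0) h0m hm, ih, hz, zero_add]
    by_cases h : q + Pi.single s 1 = q'
    · subst h
      simp
    · rw [if_neg h]
      by_cases h' : q' s = 0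
      · simp [h']
      · rw [if_neg]
        · simp
        · rintro rfl
          apply h
          ext x
          by_cases hx : x = s
          · subst hx; simp; omega
          · simp [hx]

/-- A smooth function whose Taylor coefficients of degree less than `N` vanish is `O(‖z‖ ^ N)`:
by induction on `N` its differential is `O(‖z‖ ^ (N - 1))`, and the mean value inequality on the
ball of radius `‖z‖` applies. -/
theorem isBigO_of_coeffAt_eq_zero (N : ℕ) (hG : ContDiffOn ℝ ∞ G U)
    (h : ∀ q : Fin n ⊕ Fin n → ℕ, ∑ s, q s < N → coeffAt q G = 0) :
    G =O[𝓝 0] fun z => ‖z‖ ^ N := by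
  induction N generalizing G with
  | zero =>
    simpa using (hG.continuousOn.continuousAt (hU.mem_nhds h0)).isBigO_one ℝ
  | succ N ih =>
    have hD : ∀ s, wirtinger s G =O[𝓝 0] fun z => ‖z‖ ^ N := fun s =>
      ih (wirtinger_contDiffOn hU hG s) fun q hq => by
        rw [← coeffAt_add_single hU h0 hG, h, mul_zero]
        simp only [Pi.add_apply, Finset.sum_add_distrib, Finset.sum_pi_single']
        simpa using hq
    have hF : (fun z => fderiv ℝ G z) =O[𝓝 0] fun z => ‖z‖ ^ N := by
      have : (fun z => fderiv ℝ G z) = fun z => ∑ s, wirtinger s G z • coord s := by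
        funext z
        conv_lhs => rw [eq_sum_wirtingerForm_smul_coord (fderiv ℝ G z)]
        simp only [wirtinger_apply]
      rw [this]
      refine IsBigO.fun_sum fun s _ => ?_
      simpa using (hD s).smul (isBigO_refl (fun _ => coord s) (𝓝 (0 : Fin n → ℂ))) |>.trans
        (IsBigO.of_bound ‖(coord s : (Fin n → ℂ) →L[ℝ] ℂ)‖ (by simp [norm_smul, mul_comm]))
    have hG0 : G 0 = 0 := by rw [← coeffAt_zero G, h 0 (by simp)]
    obtain ⟨C, hC⟩ := hF.bound
    obtain ⟨ε, hε, hball⟩ := Metric.eventually_nhds_iff_ball.1 (hC.and (hU.mem_nhds h0))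
    refine IsBigO.of_bound C ?_
    filter_upwards [Metric.ball_mem_nhds (0 : Fin n → ℂ) hε] with z hz
    have hsub : Metric.closedBall (0 : Fin n → ℂ) ‖z‖ ⊆ Metric.ball 0 ε :=
      Metric.closedBall_subset_ball (by simpa using hz)
    have hmv := Convex.norm_image_sub_le_of_norm_fderiv_le (𝕜 := ℝ) (f := G) (C := C * ‖z‖ ^ N)
      (s := Metric.closedBall (0 : Fin n → ℂ) ‖z‖) (x := 0) (y := z)
      (fun x hx => (hG.contDiffAt (hU.mem_nhds (hball x (hsub hx)).2)).differentiableAt (by simp))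
      (fun x hx => by
        have h1 := (hball x (hsub hx)).1
        have h2 := (hball z hz).1
        have hx' : ‖x‖ ≤ ‖z‖ := by simpa using hx
        have hCnn : 0 ≤ C ∨ ‖fderiv ℝ G x‖ = 0 := by
          by_contra! hcon
          have : ‖fderiv ℝ G x‖ ≤ 0 :=
            h1.trans (mul_nonpos_of_nonpos_of_nonneg hcon.1.le (norm_nonneg _))
          exact hcon.2 (le_antisymm this (norm_nonneg _))
        rcases hCnn with hCnn | hzero
        · refine h1.trans ?_
          rw [norm_pow, norm_norm]
          gcongr
        · rw [hzero]
          rw [norm_pow, norm_norm] at h2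
          exact (norm_nonneg _).trans h2)
      (convex_closedBall _ _) (by simp) (by simp)
    rw [hG0, sub_zero, sub_zero] at hmv
    rw [norm_pow, norm_norm, pow_succ, ← mul_assoc]
    exact hmv

/-- Taylor's formula in the variables `z`, `z̄`. The sum over `box n N` contains all the terms of
degree less than `N`, and some of higher degree. -/
theorem taylor_isBigO (hG : ContDiffOn ℝ ∞ G U) (N : ℕ) :
    (fun z => G z - ∑ q ∈ box n N, coeffAt q G * mixedMonomial q z) =O[𝓝 0] fun z => ‖z‖ ^ N := by
  have key : ∀ S : Finset (Fin n ⊕ Fin n → ℕ), ∀ q,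
      coeffAt q (fun z => G z - ∑ q ∈ S, coeffAt q G * mixedMonomial q z)
        = coeffAt q G - if q ∈ S then coeffAt q G else 0 := by
    intro S
    have hS : ∀ S : Finset (Fin n ⊕ Fin n → ℕ),
        ContDiffOn ℝ ∞ (fun z => G z - ∑ q ∈ S, coeffAt q G * mixedMonomial q z) U := fun S =>
      hG.sub (ContDiffOn.sum fun q _ => contDiffOn_const.mul (mixedMonomial_contDiff q).contDiffOn)
    induction S using Finset.induction_on with
    | empty => intro q; simp
    | insert q' S hq' ih =>
      intro q
      have : (fun z => G z - ∑ q ∈ insert q' S, coeffAt q G * mixedMonomial q z)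
          = (fun z => G z - ∑ q ∈ S, coeffAt q G * mixedMonomial q z)
            + (-coeffAt q' G) • mixedMonomial q' := by
        funext z
        simp [Finset.sum_insert hq']
        ring
      rw [this, coeffAt_add_smul hU h0 (hS S) (mixedMonomial_contDiff q').contDiffOn, ih,
        coeffAt_mixedMonomial]
      by_cases h : q = q'
      · subst h; simp [hq']
      · simp [h]
  refine isBigO_of_coeffAt_eq_zero hU h0 N
    (hG.sub (ContDiffOn.sum fun q _ => contDiffOn_const.mul (mixedMonomial_contDiff q).contDiffOn))
    fun q hq => ?_
  rw [key, if_pos, sub_self]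
  rw [mem_box]
  intro s
  exact (Finset.single_le_sum (fun _ _ => Nat.zero_le _) (Finset.mem_univ s)).trans_lt hq

end

/-! ### Supporting faces of the Newton polyhedron -/

/-- The weighted degree of `z^α z̄^β`, where `z_j` and `z̄_j` have weight `a j` and
`q = Sum.elim α β`. -/
def weight (a : Fin n → ℕ) (q : Fin n ⊕ Fin n → ℕ) : ℕ := ∑ s, Sum.elim a a s * q s

theorem sum_mul_exponentPoint (a α β : Fin n → ℕ) :
    ∑ j, (a j : ℝ) * exponentPoint α β j = (weight a (Sum.elim α β) : ℕ) := by
  simp [weight, exponentPoint, Fintype.sum_sum_type, mul_add, Finset.sum_add_distrib]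

theorem isLinearMap_weightedSum (a : Fin n → ℕ) :
    IsLinearMap ℝ fun ξ : Fin n → ℝ => ∑ j, (a j : ℝ) * ξ j :=
  ⟨fun x y => by simp [mul_add, Finset.sum_add_distrib],
    fun c x => by simp [Finset.mul_sum, mul_left_comm]⟩

theorem le_weight {a : Fin n → ℕ} (ha : ∀ j, 0 < a j) (q : Fin n ⊕ Fin n → ℕ)
    (s : Fin n ⊕ Fin n) : q s ≤ weight a q := by
  have h1 : 0 < Sum.elim a a s := by rcases s with j | j <;> exact ha j
  exact (Nat.le_mul_of_pos_left _ h1).trans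
    (Finset.single_le_sum (f := fun s => Sum.elim a a s * q s) (fun _ _ => Nat.zero_le _)
      (Finset.mem_univ s))

section
variable {F : (Fin n → ℂ) → ℝ} {a : Fin n → ℕ} {l : ℕ}
  (hl : ∀ q, coeffAt q (fun z => (F z : ℂ)) ≠ 0 → l ≤ weight a q)
include hl

theorem le_sum_of_mem_newtonPolyhedron {ξ : Fin n → ℝ} (hξ : ξ ∈ newtonPolyhedron F) :
    (l : ℝ) ≤ ∑ j, (a j : ℝ) * ξ j := by
  refine convexHull_min (t := {ξ : Fin n → ℝ | (l : ℝ) ≤ ∑ j, (a j : ℝ) * ξ j}) ?_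
    (convex_halfSpace_ge (isLinearMap_weightedSum a) _) hξ
  rintro ξ ⟨α, β, hc, hle⟩
  rw [taylorCoeff_eq_coeffAt] at hc
  calc (l : ℝ) ≤ (weight a (Sum.elim α β) : ℕ) := by exact_mod_cast hl _ hc
    _ = ∑ j, (a j : ℝ) * exponentPoint α β j := (sum_mul_exponentPoint a α β).symm
    _ ≤ _ := Finset.sum_le_sum fun j _ => by gcongr; exact hle j

/-- A point of the convex hull on which the positive functional `a` takes its minimum is a convex
combination of exponents where the minimum is attained. -/
theorem supportingFace_subset (ha : ∀ j, 0 < a j) :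
    {ξ | ξ ∈ newtonPolyhedron F ∧ ∑ j, (a j : ℝ) * ξ j = l} ⊆ convexHull ℝ
      {ξ | ∃ α β, taylorCoeff F α β ≠ 0 ∧ weight a (Sum.elim α β) = l ∧ exponentPoint α β = ξ} := by
  set E := {ξ : Fin n → ℝ | ∃ α β,
    taylorCoeff F α β ≠ 0 ∧ weight a (Sum.elim α β) = l ∧ exponentPoint α β = ξ}
  set f : (Fin n → ℝ) → ℝ := fun ξ => ∑ j, (a j : ℝ) * ξ j with hf
  have fadd : ∀ (u v : ℝ) x y, f (u • x + v • y) = u * f x + v * f y := fun u v x y => by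
    simp [hf, mul_add, Finset.sum_add_distrib, Finset.mul_sum, mul_left_comm]
  have hE : ∀ ξ ∈ convexHull ℝ E, f ξ = l := by
    intro ξ hξ
    refine convexHull_min (t := {ξ | f ξ = l}) ?_
      (convex_hyperplane (isLinearMap_weightedSum a) _) hξ
    rintro ξ ⟨α, β, -, hw, rfl⟩
    simp only [mem_ofPred_eq, hf]
    rw [sum_mul_exponentPoint, hw]
  have key : newtonPolyhedron F ⊆ {ξ | (l : ℝ) < f ξ ∨ ξ ∈ convexHull ℝ E} := by
    refine convexHull_min ?_ ?_
    · rintro ξ ⟨α, β, hc, hle⟩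
      have hle' : ∀ j, (a j : ℝ) * exponentPoint α β j ≤ a j * ξ j := fun j => by
        gcongr; exact hle j
      have h1 : f (exponentPoint α β) ≤ f ξ := Finset.sum_le_sum fun j _ => hle' j
      have h2 : (l : ℝ) ≤ f (exponentPoint α β) := by
        simp only [hf]
        rw [sum_mul_exponentPoint]
        rw [taylorCoeff_eq_coeffAt] at hc
        exact_mod_cast hl _ hc
      rcases (h2.trans h1).lt_or_eq with h | h
      · exact Or.inl h
      · refine Or.inr (subset_convexHull ℝ E ⟨α, β, hc, ?_, ?_⟩)
        · have h3 : f (exponentPoint α β) = l := le_antisymm (h1.trans h.ge) h2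
          simp only [hf] at h3
          rw [sum_mul_exponentPoint] at h3
          exact_mod_cast h3
        · have h3 : f (exponentPoint α β) = f ξ := le_antisymm h1 (h.ge.trans h2)
          have h4 := (Finset.sum_eq_sum_iff_of_le fun j _ => hle' j).1 h3
          funext j
          exact mul_left_cancel₀ (by exact_mod_cast (ha j).ne') (h4 j (Finset.mem_univ j))
    · intro x hx y hy u v hu hv huv
      simp only [mem_ofPred_eq] at hx hy ⊢
      rcases hu.eq_or_lt with rfl | hu
      · rw [zero_add] at huv; subst huv; simpa using hy
      rcases hv.eq_or_lt with rfl | hv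
      · rw [add_zero] at huv; subst huv; simpa using hx
      by_cases h : x ∈ convexHull ℝ E ∧ y ∈ convexHull ℝ E
      · exact Or.inr ((convex_convexHull ℝ E) h.1 h.2 hu.le hv.le huv)
      · left
        have hx' : (l : ℝ) ≤ f x := hx.elim le_of_lt fun h => (hE x h).ge
        have hy' : (l : ℝ) ≤ f y := hy.elim le_of_lt fun h => (hE y h).ge
        rw [fadd]
        have hl' : (l : ℝ) = u * l + v * l := by rw [← add_mul, huv, one_mul]
        rcases not_and_or.1 h with h | h
        · have := mul_lt_mul_of_pos_left (hx.resolve_right h) hu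
          have := mul_le_mul_of_nonneg_left hy' hv.le
          linarith
        · have := mul_le_mul_of_nonneg_left hx' hu.le
          have := mul_lt_mul_of_pos_left (hy.resolve_right h) hv
          linarith
  rintro ξ ⟨hξ, hξl⟩
  exact (key hξ).resolve_left fun h => h.ne' hξl

/-- The face on which a functional with positive weights is minimal is compact: it is the convex
hull of the finitely many exponents of minimal weight. -/
theorem isCompactFace_supportingFace (ha : ∀ j, 0 < a j)
    (hex : ∃ q, coeffAt q (fun z => (F z : ℂ)) ≠ 0 ∧ weight a q = l) :
    IsCompactFace (newtonPolyhedron F)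
      {ξ | ξ ∈ newtonPolyhedron F ∧ ∑ j, (a j : ℝ) * ξ j = l} := by
  refine ⟨?_, ?_, fun j => (a j : ℝ), l, fun ξ hξ => le_sum_of_mem_newtonPolyhedron hl hξ, rfl⟩
  · obtain ⟨q, hq, hw⟩ := hex
    have hq' : Sum.elim (q ∘ Sum.inl) (q ∘ Sum.inr) = q := Sum.elim_comp_inl_inr q
    refine ⟨exponentPoint (q ∘ Sum.inl) (q ∘ Sum.inr), subset_convexHull ℝ _ ⟨_, _, ?_, le_rfl⟩, ?_⟩
    · rwa [taylorCoeff_eq_coeffAt, hq']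
    · rw [sum_mul_exponentPoint, hq', hw]
  · set E := {ξ : Fin n → ℝ | ∃ α β,
      taylorCoeff F α β ≠ 0 ∧ weight a (Sum.elim α β) = l ∧ exponentPoint α β = ξ} with hE
    have hfin : E.Finite := by
      refine ((box n (l + 1)).finite_toSet.image
        fun q => exponentPoint (q ∘ Sum.inl) (q ∘ Sum.inr)).subset ?_
      rintro ξ ⟨α, β, -, hw, rfl⟩
      refine ⟨Sum.elim α β, ?_, by simp⟩
      rw [Finset.mem_coe, mem_box]
      intro s
      have := le_weight ha (Sum.elim α β) s
      omega
    have hEq : {ξ | ξ ∈ newtonPolyhedron F ∧ ∑ j, (a j : ℝ) * ξ j = l} = convexHull ℝ E := by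
      refine Subset.antisymm (supportingFace_subset hl ha) (convexHull_min ?_ ?_)
      · rintro ξ ⟨α, β, hc, hw, rfl⟩
        refine ⟨subset_convexHull ℝ _ ⟨_, _, hc, le_rfl⟩, ?_⟩
        rw [sum_mul_exponentPoint, hw]
      · exact (convex_convexHull ℝ _).inter (convex_hyperplane (isLinearMap_weightedSum a) (l : ℝ))
    rw [hEq]
    exact hfin.isCompact_convexHull ℝ

end

theorem part_supportingFace {F : (Fin n → ℂ) → ℝ} {a : Fin n → ℕ} (ha : ∀ j, 0 < a j) (l : ℕ)
    (z : Fin n → ℂ) :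
    part F {ξ | ξ ∈ newtonPolyhedron F ∧ ∑ j, (a j : ℝ) * ξ j = l} z
      = ∑ q ∈ (box n (l + 1)).filter (fun q => weight a q = l),
          coeffAt q (fun z => (F z : ℂ)) * mixedMonomial q z := by
  rw [part, finsum_mem_eq_sum_of_inter_support_eq (t := ((box n (l + 1)).filter
    (fun q => weight a q = l)).map (Equiv.sumArrowEquivProdArrow _ _ ℕ).toEmbedding),
    Finset.sum_map]
  · refine Finset.sum_congr rfl fun q _ => ?_
    rw [taylorCoeff_eq_coeffAt]
    simp only [Equiv.coe_toEmbedding, Equiv.sumArrowEquivProdArrow, Equiv.coe_fn_mk,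
      Sum.elim_comp_inl_inr, mixedMonomial, Fintype.prod_sum_type]
    rfl
  · ext ⟨α, β⟩
    simp only [mem_inter_iff, Function.mem_support, mem_ofPred_eq, Finset.mem_coe]
    refine and_congr_left fun hne => ?_
    have hc : taylorCoeff F α β ≠ 0 := left_ne_zero_of_mul hne
    rw [Finset.mem_map_equiv, Finset.mem_filter, sum_mul_exponentPoint]
    have he : (Equiv.sumArrowEquivProdArrow (Fin n) (Fin n) ℕ).symm (α, β) = Sum.elim α β := rfl
    rw [he, Nat.cast_inj]
    constructor
    · rintro ⟨-, hw⟩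
      refine ⟨mem_box.2 fun s => ?_, hw⟩
      have := le_weight ha (Sum.elim α β) s
      omega
    · rintro ⟨-, hw⟩
      exact ⟨subset_convexHull ℝ _ ⟨_, _, hc, le_rfl⟩, hw⟩

/-! ### The lowest-order part along a curve -/

theorem mixedMonomial_mul (q : Fin n ⊕ Fin n → ℕ) (z w : Fin n → ℂ) :
    mixedMonomial q (z * w) = mixedMonomial q z * mixedMonomial q w := by
  simp only [mixedMonomial, ← Finset.prod_mul_distrib, ← mul_pow]
  refine Finset.prod_congr rfl fun s _ => ?_
  rcases s with j | j <;> simp [coord]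

theorem norm_mixedMonomial_pow (q : Fin n ⊕ Fin n → ℕ) (a : Fin n → ℕ) (t : ℂ) :
    ‖mixedMonomial q (fun j => t ^ a j)‖ = ‖t‖ ^ weight a q := by
  rw [mixedMonomial, norm_prod, weight, ← Finset.prod_pow_eq_pow_sum]
  refine Finset.prod_congr rfl fun s _ => ?_
  rcases s with j | j <;> simp [coord, pow_mul]

theorem mixedMonomial_ofReal_pow (q : Fin n ⊕ Fin n → ℕ) (a : Fin n → ℕ) (x : ℝ) :
    mixedMonomial q (fun j => (x : ℂ) ^ a j) = (x : ℂ) ^ weight a q := by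
  rw [mixedMonomial, weight, ← Finset.prod_pow_eq_pow_sum]
  refine Finset.prod_congr rfl fun s _ => ?_
  rcases s with j | j <;> simp [coord, pow_mul]

theorem mixedMonomial_pow_isBigO (q : Fin n ⊕ Fin n → ℕ) (a : Fin n → ℕ) :
    (fun t : ℂ => mixedMonomial q (fun j => t ^ a j)) =O[𝓝 0] fun t => t ^ weight a q :=
  IsBigO.of_bound 1 (Filter.Eventually.of_forall fun t => by simp [norm_mixedMonomial_pow])

theorem pow_isBigO_pow {k m : ℕ} (h : k ≤ m) : (fun t : ℂ => t ^ m) =O[𝓝 0] fun t => t ^ k :=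
  IsBigO.of_bound 1 <| by
    filter_upwards [Metric.ball_mem_nhds (0 : ℂ) one_pos] with t ht
    rw [one_mul, norm_pow, norm_pow]
    exact pow_le_pow_of_le_one (norm_nonneg _) (by simpa using (mem_ball_zero_iff.1 ht).le) h

/-- Along a curve `η_j = t ^ a_j * g_j`, a smooth function agrees up to `O(t ^ (l + 1))` with its
part of minimal weight `l`, evaluated on the leading terms `t ^ a_j * g_j(0)`. -/
theorem isBigO_sub_lowestPart {U : Set (Fin n → ℂ)} (hU : IsOpen U) (h0 : (0 : Fin n → ℂ) ∈ U)
    {G : (Fin n → ℂ) → ℂ} (hG : ContDiffOn ℝ ∞ G U) {a : Fin n → ℕ} (ha : ∀ j, 0 < a j) {l : ℕ}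
    (hl : ∀ q, coeffAt q G ≠ 0 → l ≤ weight a q) {g η : ℂ → Fin n → ℂ}
    (hg : DifferentiableAt ℝ g 0) (hη : ∀ᶠ t in 𝓝 0, η t = (fun j => t ^ a j) * g t) :
    (fun t => G (η t) - ∑ q ∈ (box n (l + 1)).filter (fun q => weight a q = l),
      coeffAt q G * mixedMonomial q ((fun j => t ^ a j) * g 0)) =O[𝓝 0] fun t => t ^ (l + 1) := by
  have hO : η =O[𝓝 0] fun t => t := by
    refine IsBigO.congr' (f₁ := fun t => (fun j => t ^ a j) * g t) (g₁ := fun t => t) ?_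
      (hη.mono fun t ht => ht.symm) Filter.EventuallyEq.rfl
    refine isBigO_pi.2 fun j => ?_
    have h1 : (fun t : ℂ => t ^ a j) =O[𝓝 0] fun t => t ^ 1 := pow_isBigO_pow (ha j)
    have h2 : (fun t => g t j) =O[𝓝 0] fun _ => (1 : ℂ) :=
      ((continuous_apply j).continuousAt.comp hg.continuousAt).isBigO_one ℂ
    simpa using h1.mul h2
  have htend : Filter.Tendsto η (𝓝 0) (𝓝 0) := hO.trans_tendsto Filter.tendsto_id
  have hrem : (fun t => G (η t) - ∑ q ∈ box n (l + 1), coeffAt q G * mixedMonomial q (η t))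
      =O[𝓝 0] fun t => t ^ (l + 1) :=
    ((taylor_isBigO hU h0 hG (l + 1)).comp_tendsto htend).trans (hO.norm_left.pow (l + 1))
  have hmain : (fun t => ∑ q ∈ box n (l + 1), (coeffAt q G * mixedMonomial q (η t)
      - if weight a q = l then coeffAt q G * mixedMonomial q ((fun j => t ^ a j) * g 0) else 0))
      =O[𝓝 0] fun t => t ^ (l + 1) := by
    refine IsBigO.fun_sum fun q _ => ?_
    refine IsBigO.congr' (f₁ := fun t =>
      coeffAt q G * (mixedMonomial q (fun j => t ^ a j) * mixedMonomial q (g t))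
      - if weight a q = l then coeffAt q G * mixedMonomial q ((fun j => t ^ a j) * g 0) else 0) ?_
      (hη.mono fun t ht => by simp only [ht, mixedMonomial_mul]) Filter.EventuallyEq.rfl
    have hm : DifferentiableAt ℝ (fun t => mixedMonomial q (g t)) 0 :=
      ((mixedMonomial_contDiff q).differentiable (by simp) _).comp 0 hg
    rcases lt_trichotomy (weight a q) l with h | h | h
    · have : coeffAt q G = 0 := by
        by_contra hne
        exact absurd (hl q hne) (not_le.2 h)
      simp only [this, zero_mul, ite_self, sub_self]
      exact isBigO_zero _ _
    · simp only [h, if_true, mixedMonomial_mul, ← mul_sub]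
      refine IsBigO.const_mul_left ?_ _
      have h1 := mixedMonomial_pow_isBigO q a
      have h2 : (fun t => mixedMonomial q (g t) - mixedMonomial q (g 0))
          =O[𝓝 0] fun t : ℂ => t := by
        simpa using hm.isBigO_sub
      rw [h] at h1
      simpa only [pow_succ] using h1.mul h2
    · simp only [h.ne', if_false, sub_zero]
      refine IsBigO.const_mul_left ?_ _
      have h1 := (mixedMonomial_pow_isBigO q a).trans (pow_isBigO_pow (Nat.succ_le_of_lt h))
      simpa using h1.mul (hm.continuousAt.isBigO_one ℂ)
  refine (hrem.add hmain).congr_left fun t => ?_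
  rw [Finset.sum_sub_distrib, ← Finset.sum_filter]
  ring

/-- Nondegeneracy bounds the contact of a curve none of whose components vanishes identically by
the minimum `l` over the Newton polyhedron of the functional given by the orders `a_j`. -/
theorem exists_contact_order {U : Set (Fin n → ℂ)} (hU : IsOpen U) (h0 : (0 : Fin n → ℂ) ∈ U)
    {F : (Fin n → ℂ) → ℝ} (hF : ContDiffOn ℝ ∞ F U) (hF0 : F 0 = 0) (hnd : IsNondegenerate F)
    (hne : (newtonPolyhedron F).Nonempty) {a : Fin n → ℕ} (ha : ∀ j, 0 < a j)
    {g η : ℂ → Fin n → ℂ} (hg : DifferentiableAt ℝ g 0) (hg0 : ∀ j, g 0 j ≠ 0)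
    (hη : ∀ᶠ t in 𝓝 0, η t = (fun j => t ^ a j) * g t) :
    ∃ l : ℕ, (∀ ξ ∈ newtonPolyhedron F, (l : ℝ) ≤ ∑ j, (a j : ℝ) * ξ j) ∧
      ¬ (fun t => F (η t)) =O[𝓝 0] fun t : ℂ => t ^ (l + 1) := by
  classical
  have hG : ContDiffOn ℝ ∞ (fun z => (F z : ℂ)) U := Complex.ofRealCLM.contDiff.comp_contDiffOn hF
  have hex : ∃ l q, coeffAt q (fun z => (F z : ℂ)) ≠ 0 ∧ weight a q = l := by
    obtain ⟨ξ, α, β, hc, -⟩ := convexHull_nonempty_iff.1 hne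
    exact ⟨_, _, by rwa [taylorCoeff_eq_coeffAt] at hc, rfl⟩
  set l := Nat.find hex with hldef
  have hl : ∀ q, coeffAt q (fun z => (F z : ℂ)) ≠ 0 → l ≤ weight a q := fun q hq =>
    Nat.find_min' hex ⟨q, hq, rfl⟩
  have hlex := Nat.find_spec hex
  -- The constant term of `F` vanishes, so that every exponent has positive weight.
  have hlpos : 0 < l := by
    obtain ⟨q, hq, hw⟩ := hlex
    rw [← hldef] at hw
    rcases Nat.eq_zero_or_pos l with h | h
    · have hq0 : q = 0 := funext fun s => by
        have := le_weight ha q s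
        simp only [Pi.zero_apply]
        omega
      rw [hq0, coeffAt_zero, hF0] at hq
      simp at hq
    · exact h
  refine ⟨l, fun ξ hξ => le_sum_of_mem_newtonPolyhedron hl hξ, fun hbig => ?_⟩
  obtain ⟨t₀, ht₀⟩ := hnd _ (isCompactFace_supportingFace hl ha hlex) a (g 0)
    ⟨ha, l, hlpos, rfl⟩ hg0
  rw [part_supportingFace ha] at ht₀
  set P : ℂ → ℂ := fun t => ∑ q ∈ (box n (l + 1)).filter (fun q => weight a q = l),
      coeffAt q (fun z => (F z : ℂ)) * mixedMonomial q ((fun j => t ^ a j) * g 0) with hP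
  have hPt₀ : P t₀ ≠ 0 := by
    convert ht₀ using 7
    exact mul_comm _ _
  -- The lowest-order part is homogeneous of degree `l` on each real ray of the parameter plane.
  have hPhom : ∀ (x : ℝ), P (x * t₀) = (x : ℂ) ^ l * P t₀ := by
    intro x
    simp only [hP, Finset.mul_sum]
    refine Finset.sum_congr rfl fun q hq => ?_
    have : (fun j => ((x : ℂ) * t₀) ^ a j) = (fun j => (x : ℂ) ^ a j) * fun j => t₀ ^ a j := by
      funext j; simp [mul_pow]
    rw [this, mul_assoc, mixedMonomial_mul, mixedMonomial_ofReal_pow, (Finset.mem_filter.1 hq).2]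
    ring
  have hPO : P =O[𝓝 0] fun t => t ^ (l + 1) := by
    have h1 : (fun t => (F (η t) : ℂ)) =O[𝓝 0] fun t : ℂ => t ^ (l + 1) :=
      Complex.isBigO_ofReal_left.2 hbig
    refine (h1.sub (isBigO_sub_lowestPart hU h0 hG ha hl hg hη)).congr_left fun t => ?_
    simp [hP]
  obtain ⟨C, hC⟩ := hPO.bound
  have htend : Filter.Tendsto (fun x : ℝ => (x : ℂ) * t₀) (𝓝[>] 0) (𝓝 0) := by
    have : Continuous fun x : ℝ => (x : ℂ) * t₀ := by fun_prop
    simpa using (this.tendsto 0).mono_left nhdsWithin_le_nhds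
  have hle : ∀ᶠ x : ℝ in 𝓝[>] 0, ‖P t₀‖ ≤ C * ‖t₀‖ ^ (l + 1) * x := by
    filter_upwards [htend.eventually hC, self_mem_nhdsWithin] with x hx hx0
    have hx0 : 0 < x := hx0
    rw [hPhom, norm_mul, norm_pow, norm_pow, norm_mul, Complex.norm_real,
      Real.norm_of_nonneg hx0.le] at hx
    refine le_of_mul_le_mul_left (hx.trans_eq ?_) (pow_pos hx0 l)
    ring
  have hlim : Filter.Tendsto (fun x : ℝ => C * ‖t₀‖ ^ (l + 1) * x) (𝓝[>] 0) (𝓝 0) := by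
    have : Continuous fun x : ℝ => C * ‖t₀‖ ^ (l + 1) * x := by fun_prop
    simpa using (this.tendsto 0).mono_left nhdsWithin_le_nhds
  exact hPt₀ (norm_le_zero_iff.1 (ge_of_tendsto hlim hle))

/-! ### Vanishing along a coordinate axis -/

/-- If the Newton polyhedron misses the `k`-th axis, then no Taylor monomial survives on the complex
line of the `k`-th coordinate. -/
theorem isBigO_along_axis {U : Set (Fin n → ℂ)} (hU : IsOpen U) (h0 : (0 : Fin n → ℂ) ∈ U)
    {F : (Fin n → ℂ) → ℝ} (hF : ContDiffOn ℝ ∞ F U) {k : Fin n}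
    (hk : ∀ ξ ∈ newtonPolyhedron F, ∃ j, j ≠ k ∧ ξ j ≠ 0) (N : ℕ) :
    (fun t => F (Pi.single k t)) =O[𝓝 0] fun t : ℂ => t ^ N := by
  have hG : ContDiffOn ℝ ∞ (fun z => (F z : ℂ)) U := Complex.ofRealCLM.contDiff.comp_contDiffOn hF
  have hzero : ∀ q (t : ℂ),
      coeffAt q (fun z => (F z : ℂ)) * mixedMonomial q (Pi.single k t) = 0 := by
    intro q t
    by_contra hne
    have hc := left_ne_zero_of_mul hne
    have hm := right_ne_zero_of_mul hne
    rw [← Sum.elim_comp_inl_inr q, ← taylorCoeff_eq_coeffAt] at hc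
    obtain ⟨j, hj, hj0⟩ := hk _ (subset_convexHull ℝ _ ⟨_, _, hc, le_rfl⟩)
    rw [mixedMonomial, Finset.prod_ne_zero_iff] at hm
    have h1 := hm (Sum.inl j) (Finset.mem_univ _)
    have h2 := hm (Sum.inr j) (Finset.mem_univ _)
    simp only [coord, Sum.elim_inl, Sum.elim_inr, ContinuousLinearMap.proj_apply,
      ContinuousLinearMap.comp_apply, Pi.single_eq_of_ne hj] at h1 h2
    simp only [map_zero, ne_eq, pow_eq_zero_iff', true_and, not_not] at h1 h2
    simp [exponentPoint, h1, h2] at hj0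
  have hcont : Filter.Tendsto (fun t : ℂ => (Pi.single k t : Fin n → ℂ)) (𝓝 0) (𝓝 0) := by
    have : Continuous fun t : ℂ => (Pi.single k t : Fin n → ℂ) :=
      continuous_single (A := fun _ => ℂ) k
    simpa using this.tendsto 0
  have h := (taylor_isBigO hU h0 hG N).comp_tendsto hcont
  simp only [Function.comp_def, hzero, Finset.sum_const_zero, sub_zero] at h
  refine IsBigO.of_norm_norm (h.norm_norm.congr ?_ ?_)
  · intro t; simp
  · intro t; simp [Pi.norm_single]

/-! ### Orders of vanishing -/

section
variable {E : Type*} [NormedAddCommGroup E]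

theorem le_ord {h : ℂ → E} {k : ℕ} (hk : h =O[𝓝 0] fun t : ℂ => t ^ k) : (k : ℕ∞) ≤ ord h :=
  le_iSup₂ (f := fun (k : ℕ) (_ : h =O[𝓝 0] fun t : ℂ => t ^ k) => (k : ℕ∞)) k hk

theorem ord_le_of_not_isBigO {h : ℂ → E} {k : ℕ}
    (hk : ¬ h =O[𝓝 0] fun t : ℂ => t ^ (k + 1)) : ord h ≤ k := by
  refine iSup₂_le fun m hm => ?_
  by_contra! hlt
  exact hk (hm.trans (pow_isBigO_pow (Nat.succ_le_of_lt (by exact_mod_cast hlt))))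

theorem ord_eq_top_iff {h : ℂ → E} : ord h = ⊤ ↔ ∀ N : ℕ, h =O[𝓝 0] fun t : ℂ => t ^ N := by
  refine ⟨fun htop N => ?_, fun hO => ENat.eq_top_iff_forall_ge.2 fun N => le_ord (hO N)⟩
  by_contra hN
  have hN' : ¬ h =O[𝓝 0] fun t : ℂ => t ^ (N + 1) := fun h' =>
    hN (h'.trans (pow_isBigO_pow N.le_succ))
  have := ord_le_of_not_isBigO hN'
  rw [htop] at this
  exact absurd this (by simp)

theorem ord_ne_top_of_analyticAt [NormedSpace ℂ E] {f : ℂ → E} (hf : AnalyticAt ℂ f 0)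
    (h : ¬ ∀ᶠ t in 𝓝 0, f t = 0) : ord f ≠ ⊤ := by
  intro htop
  obtain ⟨d, g, hg, hg0, hfg⟩ := hf.exists_eventuallyEq_pow_smul_nonzero_iff.2 h
  obtain ⟨C, hC⟩ := (ord_eq_top_iff.1 htop (d + 1)).bound
  have hle : ∀ᶠ t : ℂ in 𝓝[≠] 0, ‖g t‖ ≤ C * ‖t‖ := by
    filter_upwards [nhdsWithin_le_nhds hC, nhdsWithin_le_nhds hfg, self_mem_nhdsWithin]
      with t h1 h2 h3
    rw [h2, sub_zero, norm_smul, norm_pow, norm_pow] at h1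
    refine le_of_mul_le_mul_left (h1.trans_eq ?_) (pow_pos (norm_pos_iff.2 h3) d)
    ring
  have h1 : Filter.Tendsto (fun t => ‖g t‖) (𝓝[≠] 0) (𝓝 ‖g 0‖) :=
    hg.continuousAt.norm.tendsto.mono_left nhdsWithin_le_nhds
  have h2 : Filter.Tendsto (fun t : ℂ => C * ‖t‖) (𝓝[≠] 0) (𝓝 0) := by
    have : Continuous fun t : ℂ => C * ‖t‖ := by fun_prop
    simpa using (this.tendsto 0).mono_left nhdsWithin_le_nhds
  exact hg0 (norm_le_zero_iff.1 (le_of_tendsto_of_tendsto h1 h2 hle))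

end

/-! ### Holomorphic maps and defining functions -/

/-- A holomorphic map of several variables is locally Lipschitz, by the Cauchy estimate on complex
lines. -/
theorem exists_lipschitzOnWith_of_differentiableOn {U : Set (Fin n → ℂ)} (hU : IsOpen U)
    {f : (Fin n → ℂ) → (Fin n → ℂ)} (hf : DifferentiableOn ℂ f U) {x : Fin n → ℂ} (hx : x ∈ U) :
    ∃ K : NNReal, ∃ V ∈ 𝓝 x, LipschitzOnWith K f V := by
  have hcont : ContinuousAt f x := hf.continuousOn.continuousAt (hU.mem_nhds hx)
  have hbd : ∀ᶠ y in 𝓝 x, ‖f y‖ < ‖f x‖ + 1 :=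
    hcont.norm.eventually_lt_const (lt_add_one _)
  obtain ⟨R, hR, hball⟩ := Metric.eventually_nhds_iff_ball.1 (hbd.and (hU.mem_nhds hx))
  set B := ‖f x‖ + 1
  have hB : 0 < B := by positivity
  refine ⟨(4 * B / R).toNNReal, Metric.ball x (R / 2), Metric.ball_mem_nhds x (by positivity),
    Convex.lipschitzOnWith_of_nnnorm_fderiv_le (𝕜 := ℂ) (fun y hy => ?_) (fun y hy => ?_)
      (convex_ball x _)⟩
  · have hy' : y ∈ Metric.ball x R := Metric.ball_subset_ball (by linarith) hy
    exact hf.differentiableAt (hU.mem_nhds (hball y hy').2)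
  · have hy' : y ∈ Metric.ball x R := Metric.ball_subset_ball (by linarith) hy
    have hfy : DifferentiableAt ℂ f y := hf.differentiableAt (hU.mem_nhds (hball y hy').2)
    rw [← NNReal.coe_le_coe, Real.coe_toNNReal _ (by positivity), coe_nnnorm]
    refine ContinuousLinearMap.opNorm_le_bound _ (by positivity) fun v => ?_
    rcases eq_or_ne v 0 with rfl | hv
    · simp
    have hv' : 0 < ‖v‖ := norm_pos_iff.2 hv
    have hρ : 0 < R / (4 * ‖v‖) := by positivity
    have hmem : ∀ ζ ∈ Metric.closedBall (0 : ℂ) (R / (4 * ‖v‖)), y + ζ • v ∈ Metric.ball x R := by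
      intro ζ hζ
      rw [mem_closedBall_zero_iff, le_div_iff₀ (by positivity)] at hζ
      rw [Metric.mem_ball, dist_eq_norm] at hy ⊢
      calc ‖y + ζ • v - x‖ = ‖(y - x) + ζ • v‖ := by congr 1; abel
        _ ≤ ‖y - x‖ + ‖ζ‖ * ‖v‖ := (norm_add_le _ _).trans_eq (by rw [norm_smul])
        _ < R := by nlinarith
    have hline : HasDerivAt (fun ζ : ℂ => y + ζ • v) v 0 := by
      simpa using ((hasDerivAt_id (0 : ℂ)).smul_const v).const_add y
    have hder : HasDerivAt (fun ζ : ℂ => f (y + ζ • v)) (fderiv ℂ f y v) 0 := by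
      have h1 : HasFDerivAt f (fderiv ℂ f y) (y + (0 : ℂ) • v) := by simpa using hfy.hasFDerivAt
      exact h1.comp_hasDerivAt 0 hline
    have hdiff : DifferentiableOn ℂ (fun ζ : ℂ => f (y + ζ • v))
        (Metric.closedBall 0 (R / (4 * ‖v‖))) :=
      hf.comp (by fun_prop) fun ζ hζ => (hball _ (hmem ζ hζ)).2
    have := Complex.norm_deriv_le_of_forall_mem_sphere_norm_le hρ
      (hdiff.diffContOnCl_ball Subset.rfl)
      (fun ζ hζ => (hball _ (hmem ζ (Metric.sphere_subset_closedBall hζ))).1.le)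
    rw [hder.deriv] at this
    refine this.trans_eq ?_
    field_simp

/-- If `Ψ` is Lipschitz near `q` and carries the hypersurface `A` into `B`, then the defining
function `r` of `B`, pulled back by `Ψ`, is bounded by a multiple of the defining function `ρ`
of `A`: near `q`, the distance from `w` to `A` is at most a multiple of `|ρ w|`. -/
theorem isBigO_comp_definingFunction {A B : Set (Fin n → ℂ)} {q p : Fin n → ℂ}
    {ρ r : (Fin n → ℂ) → ℝ} (hρ : IsLocalDefiningFunction A q ρ) (hqA : q ∈ A)
    (hr : IsLocalDefiningFunction B p r) {Ψ : (Fin n → ℂ) → (Fin n → ℂ)} (hΨq : Ψ q = p)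
    {V : Set (Fin n → ℂ)} (hV : V ∈ 𝓝 q) {K : NNReal} (hΨ : LipschitzOnWith K Ψ V)
    (hAB : ∀ᶠ w in 𝓝 q, w ∈ A → Ψ w ∈ B) :
    (fun w => r (Ψ w)) =O[𝓝 q] ρ := by
  obtain ⟨U, hU, hqU, hρs, hρA, hρd⟩ := hρ
  obtain ⟨U', hU', hpU', hrs, hrB, -⟩ := hr
  have hρq : ρ q = 0 := (hρA q hqU).1 hqA
  have hρc : ContDiffAt ℝ ∞ ρ q := hρs.contDiffAt (hU.mem_nhds hqU)
  have hrange : (fderiv ℝ ρ q).range = ⊤ := by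
    refine LinearMap.range_eq_top.2 (LinearMap.surjective fun h => hρd q hqU hρq ?_)
    exact ContinuousLinearMap.coe_injective h
  set S := (fderiv ℝ ρ q).nonlinearRightInverseOfSurjective hrange
  have hS : 0 < S.nnnorm :=
    ContinuousLinearMap.nonlinearRightInverseOfSurjective_nnnorm_pos _ hrange
  obtain ⟨s, hs, happ⟩ := (hρc.hasStrictFDerivAt (by simp)).approximates_deriv_on_nhds
    (c := S.nnnorm⁻¹ / 2) (Or.inr (by positivity))
  obtain ⟨K', V', hV', hrL⟩ := ((hrs.contDiffAt (hU'.mem_nhds hpU')).of_le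
    (by simp)).exists_lipschitzOnWith
  have hΨc : Filter.Tendsto Ψ (𝓝 q) (𝓝 p) := by
    have := hΨ.continuousOn.continuousAt hV
    rwa [ContinuousAt, hΨq] at this
  have hev : ∀ᶠ w in 𝓝 q, w ∈ s ∧ w ∈ V ∧ w ∈ U ∧ Ψ w ∈ V' ∧ Ψ w ∈ U' ∧ (w ∈ A → Ψ w ∈ B) := by
    filter_upwards [hs, hV, hU.mem_nhds hqU, hΨc hV', hΨc (hU'.mem_nhds hpU'), hAB]
      with w h1 h2 h3 h4 h5 h6 using ⟨h1, h2, h3, h4, h5, h6⟩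
  obtain ⟨δ, hδ, hball⟩ := Metric.eventually_nhds_iff_ball.1 hev
  set c : ℝ := (S.nnnorm : ℝ)⁻¹ / 2 with hc
  have hcpos : 0 < c := by positivity
  have hsmall : ∀ᶠ w in 𝓝 q, ‖ρ w‖ < c * (δ / 2) := by
    refine hρc.continuousAt.norm.eventually_lt_const ?_
    simp only [hρq, norm_zero]
    positivity
  refine IsBigO.of_bound (K' * (K * c⁻¹)) ?_
  filter_upwards [hsmall, Metric.ball_mem_nhds q (half_pos hδ)] with w hw hwδ
  -- The linear approximation of `ρ` yields a zero `w'` of `ρ` at distance `O(|ρ w|)` of `w`.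
  have hεδ : ‖ρ w‖ / c < δ / 2 := by rwa [div_lt_iff₀' hcpos]
  have hsub : Metric.closedBall w (‖ρ w‖ / c) ⊆ Metric.ball q δ := by
    intro x hx
    rw [Metric.mem_closedBall] at hx
    rw [Metric.mem_ball] at hwδ ⊢
    linarith [dist_triangle x w q]
  obtain ⟨w', hw', hρw'⟩ := happ.surjOn_closedBall_of_nonlinearRightInverse S
    (ε := ‖ρ w‖ / c) (b := w) (by positivity) (fun x hx => (hball x (hsub hx)).1)
    (show (0 : ℝ) ∈ _ by
      have : ((S.nnnorm : ℝ)⁻¹ - ((S.nnnorm⁻¹ / 2 : NNReal) : ℝ)) * (‖ρ w‖ / c) = ‖ρ w‖ := by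
        have : (S.nnnorm : ℝ)⁻¹ - ((S.nnnorm⁻¹ / 2 : NNReal) : ℝ) = c := by
          push_cast; rw [hc]; ring
        rw [this, mul_div_cancel₀ _ hcpos.ne']
      rw [this, Metric.mem_closedBall, dist_eq_norm, zero_sub, norm_neg])
  have H' := hball w' (hsub hw')
  have H := hball w (hsub (Metric.mem_closedBall_self (by positivity)))
  have hrw' : r (Ψ w') = 0 := (hrB _ H'.2.2.2.2.1).1 (H'.2.2.2.2.2 ((hρA _ H'.2.2.1).2 hρw'))
  calc ‖r (Ψ w)‖ = dist (r (Ψ w)) (r (Ψ w')) := by rw [hrw', dist_zero_right]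
    _ ≤ K' * dist (Ψ w) (Ψ w') := hrL.dist_le_mul _ H.2.2.2.1 _ H'.2.2.2.1
    _ ≤ K' * (K * dist w w') := by gcongr; exact hΨ.dist_le_mul _ H.2.1 _ H'.2.1
    _ ≤ K' * (K * (‖ρ w‖ / c)) := by
        gcongr; rw [dist_comm]; exact Metric.mem_closedBall.1 hw'
    _ = K' * (K * c⁻¹) * ‖ρ w‖ := by ring

section
variable {M : Set (Fin n → ℂ)} {p : Fin n → ℂ} {r ρ : (Fin n → ℂ) → ℝ}
  {Φ : OpenPartialHomeomorph (Fin n → ℂ) (Fin n → ℂ)}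

theorem IsHolomorphicCoordinate.zero_mem_target (hΦ : IsHolomorphicCoordinate p Φ) :
    (0 : Fin n → ℂ) ∈ Φ.target :=
  hΦ.map_eq_zero ▸ Φ.map_source hΦ.mem_source

theorem IsHolomorphicCoordinate.symm_zero (hΦ : IsHolomorphicCoordinate p Φ) : Φ.symm 0 = p :=
  hΦ.map_eq_zero ▸ Φ.left_inv hΦ.mem_source

theorem IsHolomorphicCoordinate.zero_mem_image (hΦ : IsHolomorphicCoordinate p Φ) (hp : p ∈ M) :
    (0 : Fin n → ℂ) ∈ Φ '' (Φ.source ∩ M) :=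
  ⟨p, ⟨hΦ.mem_source, hp⟩, hΦ.map_eq_zero⟩

theorem IsHolomorphicCoordinate.isBigO_comp (hΦ : IsHolomorphicCoordinate p Φ) (hp : p ∈ M)
    (hr : IsLocalDefiningFunction M p r) (hρ : IsDefiningFunctionOn M Φ ρ) :
    (fun z => ρ (Φ z)) =O[𝓝 p] r := by
  obtain ⟨K, V, hV, hL⟩ := exists_lipschitzOnWith_of_differentiableOn Φ.open_source
    hΦ.differentiableOn hΦ.mem_source
  refine isBigO_comp_definingFunction hr hp hρ hΦ.map_eq_zero hV hL ?_
  filter_upwards [Φ.open_source.mem_nhds hΦ.mem_source] with z hz hzM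
  exact ⟨z, ⟨hz, hzM⟩, rfl⟩

theorem IsHolomorphicCoordinate.isBigO_comp_symm (hΦ : IsHolomorphicCoordinate p Φ) (hp : p ∈ M)
    (hr : IsLocalDefiningFunction M p r) (hρ : IsDefiningFunctionOn M Φ ρ) :
    (fun w => r (Φ.symm w)) =O[𝓝 0] ρ := by
  obtain ⟨K, V, hV, hL⟩ := exists_lipschitzOnWith_of_differentiableOn Φ.open_target
    hΦ.differentiableOn_symm hΦ.zero_mem_target
  refine isBigO_comp_definingFunction hρ (hΦ.zero_mem_image hp) hr hΦ.symm_zero hV hL ?_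
  refine Filter.Eventually.of_forall ?_
  rintro _ ⟨z, ⟨hz, hzM⟩, rfl⟩
  rwa [Φ.left_inv hz]

theorem IsHolomorphicCoordinate.isBigO_symm_sub (hΦ : IsHolomorphicCoordinate p Φ) :
    (fun w => Φ.symm w - p) =O[𝓝 0] fun w => w := by
  have h := ((hΦ.differentiableOn_symm).differentiableAt
    (Φ.open_target.mem_nhds hΦ.zero_mem_target)).isBigO_sub
  simpa [hΦ.symm_zero] using h

theorem IsHolomorphicCoordinate.isBigO_map (hΦ : IsHolomorphicCoordinate p Φ) :
    Φ =O[𝓝 p] fun z => z - p := by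
  have h := ((hΦ.differentiableOn).differentiableAt
    (Φ.open_source.mem_nhds hΦ.mem_source)).isBigO_sub
  simpa [hΦ.map_eq_zero] using h

/-! ### Contact of curves with the hypersurface -/

/-- The complex line of an axis that the Newton polyhedron misses is tangent to the hypersurface to
infinite order. -/
theorem exists_regular_tangent (hp : p ∈ M) (hr : IsLocalDefiningFunction M p r)
    (hΦ : IsHolomorphicCoordinate p Φ) (hρ : IsDefiningFunctionOn M Φ ρ)
    (hconv : ¬ IsConvenient ρ) : ∃ γ ∈ regularCurves p, IsTangentToInfiniteOrder r γ := by
  unfold IsConvenient at hconv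
  push Not at hconv
  obtain ⟨k, hk⟩ := hconv
  set e : ℂ → Fin n → ℂ := fun t => Pi.single k t with he
  have heinj : Function.Injective e := Pi.single_injective (M := fun _ : Fin n => ℂ) k
  have hecont : Continuous e := continuous_single (A := fun _ => ℂ) k
  have hediff : Differentiable ℂ e :=
    (ContinuousLinearMap.single ℂ (fun _ : Fin n => ℂ) k).differentiable
  have he0 : e 0 = 0 := Pi.single_zero k
  have hetend : Filter.Tendsto e (𝓝 0) (𝓝 0) := by simpa [he0] using hecont.tendsto 0
  have htarget : ∀ᶠ t in 𝓝 0, e t ∈ Φ.target :=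
    hetend (Φ.open_target.mem_nhds hΦ.zero_mem_target)
  set γ : ℂ → Fin n → ℂ := fun t => Φ.symm (e t) with hγ
  have hγ0 : γ 0 = p := by simp only [hγ, he0, hΦ.symm_zero]
  have hγan : AnalyticAt ℂ γ 0 := by
    rw [Complex.analyticAt_iff_eventually_differentiableAt]
    filter_upwards [htarget] with t ht
    exact (hΦ.differentiableOn_symm.differentiableAt (Φ.open_target.mem_nhds ht)).comp t (hediff t)
  have hinj : InjOn γ {t | e t ∈ Φ.target} := fun t ht t' ht' h =>
    heinj (Φ.symm.injOn ht ht' h)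
  have hO : (fun t => γ t - p) =O[𝓝 0] fun t : ℂ => t ^ 1 := by
    refine (hΦ.isBigO_symm_sub.comp_tendsto hetend).trans ?_
    exact IsBigO.of_bound 1 (Filter.Eventually.of_forall fun t => by simp [he, Pi.norm_single])
  have hnot : ¬ (fun t => γ t - p) =O[𝓝 0] fun t : ℂ => t ^ (1 + 1) := by
    -- Otherwise `e = Φ ∘ γ` would also be `O(t ^ 2)`.
    intro h
    have hγtend : Filter.Tendsto γ (𝓝 0) (𝓝 p) := by
      simpa [ContinuousAt, hγ0] using hγan.continuousAt
    have h1 : e =O[𝓝 0] fun t : ℂ => t ^ 2 := by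
      refine ((hΦ.isBigO_map.comp_tendsto hγtend).trans h).congr' ?_ Filter.EventuallyEq.rfl
      filter_upwards [htarget] with t ht
      exact Φ.right_inv ht
    have h2 : (fun t : ℂ => t ^ 1) =O[𝓝 0] fun t : ℂ => t ^ 2 :=
      h1.norm_left.congr_left (fun t => by simp [he, Pi.norm_single]) |>.of_norm_left |>.congr_left
        fun t => (pow_one t).symm
    have h3 := (isLittleO_pow_pow (𝕜 := ℂ) (m := 1) (n := 2) (by norm_num))
    have h4 := h2.trans_isLittleO h3
    have h5 := isLittleO_irrefl' (f' := fun t : ℂ => t ^ 1) (l := 𝓝[≠] 0) ?_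
    · exact h5 (h4.mono nhdsWithin_le_nhds)
    · refine Filter.Eventually.frequently ?_
      filter_upwards [self_mem_nhdsWithin] with t ht
      simpa using ht
  refine ⟨γ, ⟨⟨hγan, hγ0, ?_, _, htarget, hinj⟩, ?_⟩, fun N => ?_⟩
  · intro hev
    refine hnot ((isBigO_zero (E' := Fin n → ℂ) _ _).congr' ?_ Filter.EventuallyEq.rfl)
    filter_upwards [hev] with t ht
    simp [ht]
  · exact le_antisymm (by simpa using ord_le_of_not_isBigO hnot) (by simpa using le_ord hO)
  · obtain ⟨U, hU, h0, hs, -⟩ := id hρ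
    exact ((hΦ.isBigO_comp_symm hp hr hρ).comp_tendsto hetend).trans
      (isBigO_along_axis hU h0 hs hk N)

/-- In a canonical coordinate with a convenient defining function, the contact of all curves,
relative to their order, is bounded. If `m` bounds the intercepts of the Newton polyhedron on the
axes, and `k` is the component of smallest order `d` of a curve, then the functional given by the
orders of the components takes a value at most `m * d` on the `k`-th axis. -/
theorem exists_ord_le_mul (hp : p ∈ M) (hr : IsLocalDefiningFunction M p r)
    (hΦ : IsHolomorphicCoordinate p Φ) (hρ : IsDefiningFunctionOn M Φ ρ)
    (hnd : IsNondegenerate ρ) (hconv : IsConvenient ρ) :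
    ∃ m : ℕ, ∀ γ ∈ curves p, ord (fun t => r (γ t)) ≤ m * ord fun t => γ t - p := by
  classical
  obtain ⟨U, hU, h0, hs, hzero, -⟩ := id hρ
  have hρ0 : ρ 0 = 0 := (hzero 0 h0).1 (hΦ.zero_mem_image hp)
  choose ξ hξ hξ0 using hconv
  set m : ℕ := ∑ k, ⌈ξ k k⌉₊
  have hm : ∀ k, ξ k k ≤ m := fun k => (Nat.le_ceil _).trans (by
    exact_mod_cast Finset.single_le_sum (f := fun k => ⌈ξ k k⌉₊) (fun _ _ => Nat.zero_le _)
      (Finset.mem_univ k))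
  refine ⟨m, ?_⟩
  rintro γ ⟨hγan, hγ0, hγne, -⟩
  have hγtend : Filter.Tendsto γ (𝓝 0) (𝓝 p) := by
    simpa [ContinuousAt, hγ0] using hγan.continuousAt
  have hsource : ∀ᶠ t in 𝓝 0, γ t ∈ Φ.source :=
    hγtend (Φ.open_source.mem_nhds hΦ.mem_source)
  set η : ℂ → Fin n → ℂ := fun t => Φ (γ t) with hη
  have hη0 : η 0 = 0 := by simp only [hη, hγ0, hΦ.map_eq_zero]
  have hηan : AnalyticAt ℂ η 0 := by
    rw [Complex.analyticAt_iff_eventually_differentiableAt]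
    filter_upwards [hsource, hγan.eventually_analyticAt] with t ht ht'
    exact (hΦ.differentiableOn.differentiableAt (Φ.open_source.mem_nhds ht)).comp t
      ht'.differentiableAt
  have hηj : ∀ j, AnalyticAt ℂ (fun t => η t j) 0 := fun j => analyticAt_pi_iff.1 hηan j
  have hηtend : Filter.Tendsto η (𝓝 0) (𝓝 0) := by
    simpa [ContinuousAt, hη0] using hηan.continuousAt
  have hsymm : ∀ᶠ t in 𝓝 0, Φ.symm (η t) = γ t := hsource.mono fun t ht => Φ.left_inv ht
  -- The component `k` has the smallest order `d` of vanishing; it is finite.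
  obtain ⟨i, hi⟩ : ∃ j, analyticOrderAt (fun t => η t j) 0 ≠ ⊤ := by
    by_contra! hall
    refine hγne ?_
    have := Filter.eventually_all.2 fun j => analyticOrderAt_eq_top.1 (hall j)
    filter_upwards [this, hsymm] with t h1 h2
    rw [← h2, show η t = 0 from funext h1, hΦ.symm_zero]
  obtain ⟨k, -, hk⟩ := Finset.exists_min_image Finset.univ
    (fun j => analyticOrderAt (fun t => η t j) 0) ⟨i, Finset.mem_univ i⟩
  have hktop : analyticOrderAt (fun t => η t k) 0 ≠ ⊤ :=
    ((hk i (Finset.mem_univ i)).trans_lt (lt_top_iff_ne_top.2 hi)).ne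
  obtain ⟨d, hd⟩ := ENat.ne_top_iff_exists.1 hktop
  -- The components that vanish identically are replaced by a high power of `t`.
  have hcomp : ∀ j, ∃ a : ℕ, ∃ g : ℂ → ℂ, d ≤ a ∧ 0 < a ∧ (j = k → a = d) ∧
      AnalyticAt ℂ g 0 ∧ g 0 ≠ 0 ∧
      (fun t => t ^ a * g t - η t j) =O[𝓝 0] (fun t : ℂ => t ^ (m * d + d + 1)) := by
    intro j
    by_cases hj : analyticOrderAt (fun t => η t j) 0 = ⊤
    · refine ⟨m * d + d + 1, fun _ => 1, by omega, by omega, ?_, analyticAt_const, one_ne_zero, ?_⟩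
      · rintro rfl; exact absurd hj hktop
      · refine (isBigO_refl _ _).congr' ?_ Filter.EventuallyEq.rfl
        filter_upwards [analyticOrderAt_eq_top.1 hj] with t ht
        simp [ht]
    · obtain ⟨a, ha⟩ := ENat.ne_top_iff_exists.1 hj
      obtain ⟨g, hg, hg0, hgη⟩ := (hηj j).analyticOrderAt_eq_natCast.1 ha.symm
      refine ⟨a, g, ?_, ?_, ?_, hg, hg0, ?_⟩
      · have := hk j (Finset.mem_univ j)
        rw [← hd, ← ha] at this
        exact_mod_cast this
      · rcases Nat.eq_zero_or_pos a with h | h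
        · rw [h] at hgη
          have := hgη.self_of_nhds
          simp [hη0] at this
          exact absurd this.symm hg0
        · exact h
      · rintro rfl
        rw [← hd] at ha
        exact_mod_cast ha
      · refine (isBigO_zero _ _).congr' ?_ Filter.EventuallyEq.rfl
        filter_upwards [hgη] with t ht
        simp [ht]
  choose a g had hapos hak hgan hg0 hdiff using hcomp
  -- The perturbed curve has the same contact with `ρ` up to order `m * d`.
  set η' : ℂ → Fin n → ℂ := fun t => (fun j => t ^ a j) * fun j => g j t with hη'
  have hη'an : AnalyticAt ℂ η' 0 := analyticAt_pi_iff.2 fun j =>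
    (analyticAt_id.pow (a j)).mul (hgan j)
  have hη'0 : η' 0 = 0 := funext fun j => by simp [hη', (hapos j).ne']
  have hη'tend : Filter.Tendsto η' (𝓝 0) (𝓝 0) := by
    simpa [ContinuousAt, hη'0] using hη'an.continuousAt
  have hηη' : (fun t => η' t - η t) =O[𝓝 0] fun t : ℂ => t ^ (m * d + d + 1) :=
    isBigO_pi.2 hdiff
  have hρη : (fun t => ρ (η' t) - ρ (η t)) =O[𝓝 0] fun t : ℂ => t ^ (m * d + d + 1) := by
    obtain ⟨K, V, hV, hL⟩ :=
      ((hs.contDiffAt (hU.mem_nhds h0)).of_le (by simp)).exists_lipschitzOnWith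
    refine IsBigO.trans (IsBigO.of_bound K ?_) hηη'
    filter_upwards [hηtend hV, hη'tend hV] with t h1 h2
    simpa [dist_eq_norm] using hL.dist_le_mul _ h2 _ h1
  obtain ⟨l, hl, hlO⟩ := exists_contact_order hU h0 hs hρ0 hnd ⟨_, hξ k⟩ hapos
    (g := fun t j => g j t) (η := η')
    ((analyticAt_pi_iff.2 hgan).differentiableAt.restrictScalars ℝ) hg0
    (Filter.Eventually.of_forall fun t => rfl)
  have hlmd : l ≤ m * d := by
    have h1 := hl _ (hξ k)
    rw [Finset.sum_eq_single k (fun j _ hj => by rw [hξ0 k j hj, mul_zero]) (by simp),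
      hak k rfl] at h1
    have h2 : (d : ℝ) * ξ k k ≤ d * m := by gcongr; exact hm k
    have h3 : (l : ℝ) ≤ (m * d : ℕ) := by push_cast; linarith
    exact_mod_cast h3
  have hord : ord (fun t => r (γ t)) ≤ (m * d : ℕ) := by
    refine ord_le_of_not_isBigO fun hO => hlO ?_
    have h1 : (fun t => ρ (η t)) =O[𝓝 0] fun t : ℂ => t ^ (m * d + 1) :=
      ((hΦ.isBigO_comp hp hr hρ).comp_tendsto hγtend).trans hO
    have h2 := h1.add (hρη.trans (pow_isBigO_pow (by omega : m * d + 1 ≤ m * d + d + 1)))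
    exact (h2.congr_left fun t => by ring).trans (pow_isBigO_pow (by omega))
  have hd' : (d : ℕ∞) ≤ ord fun t => γ t - p := by
    refine le_ord ?_
    have h1 : η' =O[𝓝 0] fun t : ℂ => t ^ d := isBigO_pi.2 fun j => by
      simpa [hη'] using (pow_isBigO_pow (had j)).mul ((hgan j).continuousAt.isBigO_one ℂ)
    have h2 : η =O[𝓝 0] fun t : ℂ => t ^ d :=
      (h1.sub (hηη'.trans (pow_isBigO_pow (by omega)))).congr_left fun t => by simp
    refine ((hΦ.isBigO_symm_sub.comp_tendsto hηtend).trans h2).congr' ?_ Filter.EventuallyEq.rfl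
    filter_upwards [hsymm] with t ht
    simp [ht]
  calc ord (fun t => r (γ t)) ≤ (m * d : ℕ) := hord
    _ = (m : ℕ∞) * d := by push_cast; rfl
    _ ≤ _ := by gcongr

end

end

end RealHypersurface

/-- `M` is a real hypersurface of `ℂⁿ` near its point `p`, and `r` is any local defining function
for it near `p`, through which the types and orders of contact are expressed. -/
theorem theorem1p3 {n : ℕ} (M : Set (Fin n → ℂ)) (p : Fin n → ℂ) (hp : p ∈ M)
    (r : (Fin n → ℂ) → ℝ) (hr : IsLocalDefiningFunction M p r)
    (hcan : ∃ Φ, IsCanonicalCoordinate M p Φ) :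
    List.TFAE [
      dAngeloType r p = ⊤,
      regularType r p = ⊤,
      ∃ γ ∈ regularCurves p, IsTangentToInfiniteOrder r γ,
      ∃ γ ∈ curves p, IsTangentToInfiniteOrder r γ,
      ∃ Φ, IsHolomorphicCoordinate p Φ ∧ ∃ ρ, IsDefiningFunctionOn M Φ ρ ∧ ¬ IsConvenient ρ] := by
  obtain ⟨Φ, hΦ, ρ, hρ, hnd⟩ := hcan
  tfae_have 5 → 3 := by
    rintro ⟨Ψ, hΨ, σ, hσ, hconv⟩
    exact exists_regular_tangent hp hr hΨ hσ hconv
  tfae_have 3 → 4 := fun ⟨γ, hγ, htan⟩ => ⟨γ, hγ.1, htan⟩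
  tfae_have 3 → 2 := by
    rintro ⟨γ, hγ, htan⟩
    refine top_le_iff.1 ?_
    rw [← ord_eq_top_iff.2 htan]
    exact le_iSup₂ (f := fun γ (_ : γ ∈ regularCurves p) => ord fun t => r (γ t)) γ hγ
  tfae_have 4 → 1 := by
    rintro ⟨γ, hγ, htan⟩
    refine top_le_iff.1 (le_trans ?_ (le_iSup₂ (f := fun γ (_ : γ ∈ curves p) =>
      (ord (fun t => r (γ t)) : ENNReal) / (ord (fun t => γ t - p) : ENNReal)) γ hγ))
    have hne : ord (fun t => γ t - p) ≠ ⊤ :=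
      ord_ne_top_of_analyticAt (hγ.1.sub analyticAt_const) (by simpa [sub_eq_zero] using hγ.2.2.1)
    simp only [ord_eq_top_iff.2 htan, ENat.toENNReal_top]
    rw [ENNReal.top_div_of_ne_top (by simpa using hne)]
  tfae_have 1 → 5 := by
    intro htop
    refine ⟨Φ, hΦ, ρ, hρ, fun hconv => ?_⟩
    obtain ⟨m, hm⟩ := exists_ord_le_mul hp hr hΦ hρ hnd hconv
    have hle : dAngeloType r p ≤ (m : ENNReal) := iSup₂_le fun γ hγ => by
      refine ENNReal.div_le_of_le_mul ?_
      have := ENat.toENNReal_mono (hm γ hγ)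
      simpa using this
    rw [htop, top_le_iff] at hle
    exact ENNReal.natCast_ne_top m hle
  tfae_have 2 → 5 := by
    intro htop
    refine ⟨Φ, hΦ, ρ, hρ, fun hconv => ?_⟩
    obtain ⟨m, hm⟩ := exists_ord_le_mul hp hr hΦ hρ hnd hconv
    have hle : regularType r p ≤ (m : ℕ∞) := iSup₂_le fun γ hγ => by
      have := hm γ hγ.1
      rwa [hγ.2, mul_one] at this
    rw [htop, top_le_iff] at hle
    exact ENat.natCast_ne_top m hle
  tfae_finish
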